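/- Let $1<p\le q<\infty$, $p^*=p/(p-1)$, and let $$k_{q,p}=\left(\frac{r}{B(1/r,(q-1)/r)}\right)^{1/p-1/q}\quad\text{with } r=\frac qp-1,\ B(a,b)=\int_0^1x^{a-1}(1-x)^{b-1}\,dx,\qquad\text{if } p<q,$$ and $k_{p,p}=p^{1/p}(p^*)^{1/p^*}$ if $p=q$. Let $\nu$ be a Borel measure on $\mathbb R$, put $S(x)=\nu((-\infty,x])\in[0,\infty]$ for $x\in\mathbb R$, and suppose that $S(+\infty):=\lim_{x\to+\infty}S(x)=+\infty$. Use the conventions $0^{-q/p^*}=\infty$ and $\infty^{-q/p^*}=0$. (a) If $S(x)<\infty$ for all $x\in\mathbb R$, then there is a Borel measure $\widetilde\nu$ on $\mathbb R$ such that $$\widetilde\nu((x,+\infty))=S(x)^{-q/p^*}\quad\text{for all }x\in\mathbb R.\qquad(*)$$ (b) For every Borel measure $\widetilde\nu$ on $\mathbb R$ satisfying $(*)$ and every Borel measurable function $f:\mathbb R\to[0,\infty)$, $$\left[\int_{\mathbb R}\left(\int_{(-\infty,x)}f(y)\,\nu(dy)\right)^q\widetilde\nu(dx)\right]^{1/q}\le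 k_{q,p}\left[\int_{\mathbb R}f(y)^p\,\nu(dy)\right]^{1/p},$$ where both sides may be $+\infty$. -/

import Mathlib

open MeasureTheory Filter Topology Set
open scoped ENNReal

noncomputable section

/-- Euler's beta integral `B(a, b) = ∫₀¹ x ^ (a - 1) * (1 - x) ^ (b - 1) dx`
(convergent for `a, b > 0`). -/
def eulerBeta (a b : ℝ) : ℝ :=
  ∫ x in (0 : ℝ)..1, x ^ (a - 1) * (1 - x) ^ (b - 1)

/-- The sharp factor `k_{q,p}`, where `r = q / p - 1` and `p* = p / (p - 1)`. For `p < q` it is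
`(r / B(1 / r, (q - 1) / r)) ^ (1 / p - 1 / q)`. That formula has no meaning at `p = q`
(`r = 0`), where the factor is `p ^ (1 / p) * (p*) ^ (1 / p*)`. -/
def sharpFactor (q p : ℝ) : ℝ :=
  if p = q then
    p ^ (1 / p) * p.conjExponent ^ (1 / p.conjExponent)
  else
    ((q / p - 1) / eulerBeta (1 / (q / p - 1)) ((q - 1) / (q / p - 1))) ^ (1 / p - 1 / q)

/-- The cumulative distribution function `S(x) = ν((-∞, x])` of a Borel measure, with values
in `[0, ∞]`. -/
def cumul (ν : Measure ℝ) (x : ℝ) : ℝ≥0∞ :=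
  ν (Iic x)

/-- `ν'` is a Borel measure with `ν'((x, ∞)) = S(x) ^ (-q / p*)` for every real `x`,
with the conventions `0 ^ (-q / p*) = ∞` and `∞ ^ (-q / p*) = 0`. -/
def HasBlissTail (q p : ℝ) (ν ν' : Measure ℝ) : Prop :=
  ∀ x : ℝ, ν' (Ioi x) = cumul ν x ^ (-(q / p.conjExponent))

end

/-! Write α = q/p*. The quantile function T of ν, the left-continuous inverse of S, satisfies T(s) ≤
x iff s ≤ S(x) for s > 0. It therefore carries Lebesgue measure on (0,∞) to a measure with
distribution function S, and α t^(-α-1) dt to a measure with tail S^(-α). This yields (a) and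
reduces (b) to an inequality on the half-line for f ∘ T (`bliss_halfLine`), because the parameters s
with T(s) < T(t) lie in (0,t]. Two defects are harmless: S may reach ∞, where f ∘ T is cut to 0, and
ν' is not determined by (*) where ν has no mass strictly to the left, but the inner integral
vanishes there.

For p < q the half-line inequality (Bliss) is proved by mass transport. Let r = q/p - 1, let F be
the primitive of f, and let θ push F^q x^(-α-1) dx / c monotonically to the beta density t^(1/r)
(1-t)^(α/r-1) on (0,1). With w = x^(-(α+1)/p*) ((1-θ)/θ)^(1/p*), integrating the derivative of
F^(α+1) w gives ∫ F^(α+1) (-w') ≤ (α+1) ∫ f F^α w. On the left, -w'/w is a positive combination of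
1/x and θ'/(θ(1-θ)); weighted AM-GM (`transport_amgm`) bounds the integrand below by a multiple of
θ' times a beta density at θ. On the right, Hölder leaves the L^p norm of f and, by
`transport_conjugate_identity`, a second beta integral. Both beta integrals are explicit, so f
survives only in its norm and in c, which encodes the left side of the inequality; solving for c
gives the sharp factor (`sharpFactor_identity`). AM-GM is an equality exactly when θ/(1-θ) is a
multiple of x^r, as for Bliss's extremals.

For p = q, integration by parts and Hölder suffice (`IsRegularDensity.hardy`). Both cases are first
proved for regular densities and extended by L^p approximation and Fatou. -/

/-! ### The beta integral. -/

theorem ofReal_betaIntegrand {a b x : ℝ} (hx : x ∈ Icc (0 : ℝ) 1) :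
    (x : ℂ) ^ ((a : ℂ) - 1) * (1 - (x : ℂ)) ^ ((b : ℂ) - 1) =
      ((x ^ (a - 1) * (1 - x) ^ (b - 1) : ℝ) : ℂ) := by
  have h1 : 0 ≤ 1 - x := by linarith [hx.2]
  rw [Complex.ofReal_mul, Complex.ofReal_cpow hx.1, Complex.ofReal_cpow h1]
  push_cast
  rfl

theorem intervalIntegrable_betaIntegrand {a b : ℝ} (ha : 0 < a) (hb : 0 < b) :
    IntervalIntegrable (fun x : ℝ => x ^ (a - 1) * (1 - x) ^ (b - 1)) volume 0 1 := by
  have h := Complex.betaIntegral_convergent (u := a) (v := b) (by simpa) (by simpa)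
  rw [intervalIntegrable_iff_integrableOn_Ioc_of_le zero_le_one] at h ⊢
  refine IntegrableOn.congr_fun (f := fun x : ℝ =>
    ((x : ℂ) ^ ((a : ℂ) - 1) * (1 - (x : ℂ)) ^ ((b : ℂ) - 1)).re) h.re ?_ measurableSet_Ioc
  intro x hx
  simp only
  rw [ofReal_betaIntegrand ⟨hx.1.le, hx.2⟩, Complex.ofReal_re]

theorem eulerBeta_eq_beta {a b : ℝ} (ha : 0 < a) (hb : 0 < b) :
    eulerBeta a b = ProbabilityTheory.beta a b := by
  rw [ProbabilityTheory.beta_eq_betaIntegralReal a b ha hb, eulerBeta, Complex.betaIntegral]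
  rw [intervalIntegral.integral_congr (g := fun x : ℝ =>
    ((x ^ (a - 1) * (1 - x) ^ (b - 1) : ℝ) : ℂ)), intervalIntegral.integral_ofReal,
    Complex.ofReal_re]
  intro x hx
  rw [uIcc_of_le zero_le_one] at hx
  exact ofReal_betaIntegrand hx

theorem eulerBeta_pos {a b : ℝ} (ha : 0 < a) (hb : 0 < b) : 0 < eulerBeta a b := by
  rw [eulerBeta_eq_beta ha hb]
  exact ProbabilityTheory.beta_pos ha hb

theorem eulerBeta_add_one_right {a b : ℝ} (ha : 0 < a) (hb : 0 < b) :
    eulerBeta a (b + 1) = b / (a + b) * eulerBeta a b := by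
  rw [eulerBeta_eq_beta ha (by linarith), eulerBeta_eq_beta ha hb, ProbabilityTheory.beta,
    ProbabilityTheory.beta, ← add_assoc, Real.Gamma_add_one hb.ne',
    Real.Gamma_add_one (add_pos ha hb).ne']
  have := (Real.Gamma_pos_of_pos (add_pos ha hb)).ne'
  have := (add_pos ha hb).ne'
  field_simp

theorem eulerBeta_add_one_left {a b : ℝ} (ha : 0 < a) (hb : 0 < b) :
    eulerBeta (a + 1) b = a / (a + b) * eulerBeta a b := by
  rw [eulerBeta_eq_beta (by linarith) hb, eulerBeta_eq_beta ha hb, ProbabilityTheory.beta,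
    ProbabilityTheory.beta, add_right_comm, Real.Gamma_add_one ha.ne',
    Real.Gamma_add_one (add_pos ha hb).ne']
  have := (Real.Gamma_pos_of_pos (add_pos ha hb)).ne'
  have := (add_pos ha hb).ne'
  field_simp

theorem lintegral_betaIntegrand {a b : ℝ} (ha : 0 < a) (hb : 0 < b) :
    ∫⁻ x in Ioo (0 : ℝ) 1, ENNReal.ofReal (x ^ (a - 1) * (1 - x) ^ (b - 1)) =
      ENNReal.ofReal (eulerBeta a b) := by
  have h := intervalIntegrable_betaIntegrand ha hb
  rw [intervalIntegrable_iff_integrableOn_Ioc_of_le zero_le_one] at h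
  rw [eulerBeta, intervalIntegral.integral_of_le zero_le_one,
    ofReal_integral_eq_lintegral_ofReal h, restrict_Ioo_eq_restrict_Ioc]
  filter_upwards [ae_restrict_mem measurableSet_Ioc] with x hx
  have h1 : 0 ≤ 1 - x := by linarith [hx.2]
  have h0 : 0 ≤ x := hx.1.le
  simp only [Pi.zero_apply]
  positivity

/-! ### Monotone transport between intervals. -/

/-- The filters `l₁` and `l₂` stand for approach to the two ends of the interval, so that finite and
infinite ends are treated alike. Openness leaves room on both sides of each point, which makes the
bounds by the limits strict. -/
theorem StrictMonoOn.image_eq_Ioo_of_tendsto {s : Set ℝ} (hs : IsPreconnected s) (hso : IsOpen s)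
    {l₁ l₂ : Filter ℝ} [l₁.NeBot] [l₂.NeBot] (hl₁ : l₁ ≤ 𝓟 s) (hl₂ : l₂ ≤ 𝓟 s)
    (h₁ : ∀ x ∈ s, ∀ᶠ y in l₁, y < x) (h₂ : ∀ x ∈ s, ∀ᶠ y in l₂, x < y) {g : ℝ → ℝ} {u v : ℝ}
    (hg : StrictMonoOn g s) (hgc : ContinuousOn g s) (hu : Tendsto g l₁ (𝓝 u))
    (hv : Tendsto g l₂ (𝓝 v)) : g '' s = Ioo u v := by
  refine Subset.antisymm ?_ (hs.intermediate_value_Ioo hl₁ hl₂ hgc hu hv)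
  have hlow : ∀ x ∈ s, u ≤ g x := fun x hx => le_of_tendsto hu <| by
    filter_upwards [h₁ x hx, hl₁ (mem_principal_self s)] with y hy hys using (hg hys hx hy).le
  have hupp : ∀ x ∈ s, g x ≤ v := fun x hx => ge_of_tendsto hv <| by
    filter_upwards [h₂ x hx, hl₂ (mem_principal_self s)] with y hy hys using (hg hx hys hy).le
  rintro _ ⟨x, hx, rfl⟩
  obtain ⟨ε, hε, hball⟩ := Metric.isOpen_iff.1 hso x hx
  have hm : x - ε / 2 ∈ s := hball (by
    rw [Metric.mem_ball, Real.dist_eq, abs_lt]; constructor <;> linarith)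
  have hp : x + ε / 2 ∈ s := hball (by
    rw [Metric.mem_ball, Real.dist_eq, abs_lt]; constructor <;> linarith)
  exact ⟨(hlow _ hm).trans_lt (hg hm hx (by linarith)),
    (hg hx hp (by linarith)).trans_le (hupp _ hp)⟩

/-- The monotone rearrangement `θ` of `(0, ∞)` onto `(0, 1)` with `I ∘ θ = Z`. -/
theorem exists_monotone_transport {Z ζ I β : ℝ → ℝ} {m : ℝ}
    (hZ : ∀ x > 0, HasDerivAt Z (ζ x) x) (hζ : ∀ x > 0, 0 < ζ x)
    (hZ0 : Tendsto Z (𝓝[>] 0) (𝓝 0)) (hZ1 : Tendsto Z atTop (𝓝 m))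
    (hI : ∀ t ∈ Ioo (0 : ℝ) 1, HasDerivAt I (β t) t) (hβ : ∀ t ∈ Ioo (0 : ℝ) 1, 0 < β t)
    (hI0 : Tendsto I (𝓝[>] 0) (𝓝 0)) (hI1 : Tendsto I (𝓝[<] 1) (𝓝 m)) :
    ∃ θ : ℝ → ℝ, (∀ x > 0, θ x ∈ Ioo (0 : ℝ) 1) ∧ (∀ x > 0, I (θ x) = Z x) ∧
      (∀ x > 0, HasDerivAt θ (ζ x / β (θ x)) x) ∧ StrictMonoOn θ (Ioi 0) ∧
      θ '' Ioi 0 = Ioo 0 1 := by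
  have hZmono : StrictMonoOn Z (Ioi 0) := by
    refine strictMonoOn_of_deriv_pos (convex_Ioi 0)
      (fun x hx => (hZ x hx).continuousAt.continuousWithinAt) fun x hx => ?_
    rw [interior_Ioi] at hx
    rw [(hZ x hx).deriv]
    exact hζ x hx
  have hImono : StrictMonoOn I (Ioo 0 1) := by
    refine strictMonoOn_of_deriv_pos (convex_Ioo 0 1)
      (fun x hx => (hI x hx).continuousAt.continuousWithinAt) fun x hx => ?_
    rw [interior_Ioo] at hx
    rw [(hI x hx).deriv]
    exact hβ x hx
  have hZim : Z '' Ioi 0 = Ioo 0 m :=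
    hZmono.image_eq_Ioo_of_tendsto isPreconnected_Ioi isOpen_Ioi (l₁ := 𝓝[>] 0) (l₂ := atTop)
      inf_le_right (le_principal_iff.2 (Ioi_mem_atTop 0))
      (fun x hx => nhdsWithin_le_nhds (Iio_mem_nhds hx)) (fun x _ => Ioi_mem_atTop x)
      (fun x hx => (hZ x hx).continuousAt.continuousWithinAt) hZ0 hZ1
  have hIim : I '' Ioo 0 1 = Ioo 0 m :=
    hImono.image_eq_Ioo_of_tendsto isPreconnected_Ioo isOpen_Ioo (l₁ := 𝓝[>] 0) (l₂ := 𝓝[<] 1)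
      (le_principal_iff.2 (Ioo_mem_nhdsGT one_pos)) (le_principal_iff.2 (Ioo_mem_nhdsLT one_pos))
      (fun x hx => nhdsWithin_le_nhds (Iio_mem_nhds hx.1))
      (fun x hx => nhdsWithin_le_nhds (Ioi_mem_nhds hx.2))
      (fun x hx => (hI x hx).continuousAt.continuousWithinAt) hI0 hI1
  have hex : ∀ x : ℝ, ∃ t : ℝ, 0 < x → t ∈ Ioo (0 : ℝ) 1 ∧ I t = Z x := by
    intro x
    by_cases hx : 0 < x
    · have : Z x ∈ I '' Ioo 0 1 := by
        rw [hIim, ← hZim]; exact mem_image_of_mem Z hx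
      obtain ⟨t, ht, h⟩ := this
      exact ⟨t, fun _ => ⟨ht, h⟩⟩
    · exact ⟨0, fun h => absurd h hx⟩
  choose θ hθ using hex
  have hmono : StrictMonoOn θ (Ioi 0) := by
    intro x hx y hy hxy
    by_contra! hle
    have := hImono.monotoneOn (hθ y hy).1 (hθ x hx).1 hle
    rw [(hθ y hy).2, (hθ x hx).2] at this
    exact absurd (hZmono hx hy hxy) (not_lt.2 this)
  have him : θ '' Ioi 0 = Ioo 0 1 := by
    refine Subset.antisymm (image_subset_iff.2 fun x hx => (hθ x hx).1) fun t ht => ?_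
    have : I t ∈ Z '' Ioi 0 := by
      rw [hZim, ← hIim]; exact mem_image_of_mem I ht
    obtain ⟨x, hx, h⟩ := this
    exact ⟨x, hx, hImono.injOn (hθ x hx).1 ht ((hθ x hx).2.trans h)⟩
  refine ⟨θ, fun x hx => (hθ x hx).1, fun x hx => (hθ x hx).2, fun x hx => ?_, hmono, him⟩
  -- A monotone function whose image is a neighbourhood of the value cannot jump.
  have hcont : ContinuousAt θ x := hmono.continuousAt_of_image_mem_nhds (Ioi_mem_nhds hx) (by
    rw [him]; exact isOpen_Ioo.mem_nhds (hθ x hx).1)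
  have hd := hI _ (hθ x hx).1
  have hne := (hβ _ (hθ x hx).1).ne'
  rw [hasDerivAt_iff_tendsto_slope] at hd ⊢
  have hZs := hasDerivAt_iff_tendsto_slope.1 (hZ x hx)
  have hθt : Tendsto θ (𝓝[≠] x) (𝓝[≠] (θ x)) := by
    refine tendsto_nhdsWithin_iff.2 ⟨hcont.mono_left nhdsWithin_le_nhds, ?_⟩
    filter_upwards [self_mem_nhdsWithin, nhdsWithin_le_nhds (Ioi_mem_nhds hx)] with y hy hy0
    exact fun h => hy (hmono.injOn hy0 hx h)
  -- Since I ∘ θ = Z, the slope of θ is the slope of Z divided by the slope of I between the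
  -- corresponding values of θ.
  refine (hZs.div (hd.comp hθt) hne).congr' ?_
  filter_upwards [self_mem_nhdsWithin, nhdsWithin_le_nhds (Ioi_mem_nhds hx)] with y hy hy0
  have h1 : θ y - θ x ≠ 0 := sub_ne_zero.2 fun h => hy (hmono.injOn hy0 hx h)
  have h2 : y - x ≠ 0 := sub_ne_zero.2 hy
  have h3 : Z y - Z x ≠ 0 := sub_ne_zero.2 fun h => hy (hZmono.injOn hy0 hx h)
  simp only [Pi.div_apply, Function.comp_apply, slope_def_field]
  rw [(hθ y hy0).2, (hθ x hx).2]
  field_simp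

/-! ### The incomplete beta integral. -/

noncomputable section

/-- The incomplete beta integral. -/
def incompleteBeta (a b t : ℝ) : ℝ :=
  ∫ x in (0 : ℝ)..t, x ^ (a - 1) * (1 - x) ^ (b - 1)

end

section incompleteBeta

variable {a b : ℝ}

theorem continuousAt_betaIntegrand {t : ℝ} (ht : t ∈ Ioo (0 : ℝ) 1) :
    ContinuousAt (fun x : ℝ => x ^ (a - 1) * (1 - x) ^ (b - 1)) t := by
  have h1 : 1 - t ≠ 0 := by linarith [ht.2]
  exact (Real.continuousAt_rpow_const _ _ (Or.inl ht.1.ne')).mul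
    ((continuousAt_const.sub continuousAt_id).rpow_const (Or.inl h1))

theorem continuousOn_betaIntegrand :
    ContinuousOn (fun x : ℝ => x ^ (a - 1) * (1 - x) ^ (b - 1)) (Ioo 0 1) :=
  fun _ ht => (continuousAt_betaIntegrand ht).continuousWithinAt

theorem hasDerivAt_incompleteBeta (ha : 0 < a) (hb : 0 < b) {t : ℝ} (ht : t ∈ Ioo (0 : ℝ) 1) :
    HasDerivAt (incompleteBeta a b) (t ^ (a - 1) * (1 - t) ^ (b - 1)) t := by
  refine intervalIntegral.integral_hasDerivAt_right ?_ ?_ (continuousAt_betaIntegrand ht)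
  · refine (intervalIntegrable_betaIntegrand ha hb).mono_set ?_
    rw [uIcc_of_le ht.1.le, uIcc_of_le zero_le_one]
    exact Icc_subset_Icc_right ht.2.le
  · exact continuousOn_betaIntegrand.stronglyMeasurableAtFilter isOpen_Ioo t ht

theorem continuousOn_incompleteBeta (ha : 0 < a) (hb : 0 < b) :
    ContinuousOn (incompleteBeta a b) (Icc 0 1) := by
  have h := intervalIntegral.continuousOn_primitive_interval'
    (intervalIntegrable_betaIntegrand ha hb) (left_mem_uIcc)
  rwa [uIcc_of_le zero_le_one] at h

theorem tendsto_incompleteBeta_zero (ha : 0 < a) (hb : 0 < b) :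
    Tendsto (incompleteBeta a b) (𝓝[>] 0) (𝓝 0) := by
  have h := continuousOn_incompleteBeta ha hb 0 (left_mem_Icc.2 zero_le_one)
  rw [ContinuousWithinAt, incompleteBeta, intervalIntegral.integral_same] at h
  refine h.mono_left (nhdsWithin_le_of_mem ?_)
  exact mem_of_superset (Ioo_mem_nhdsGT one_pos) Ioo_subset_Icc_self

theorem tendsto_incompleteBeta_one (ha : 0 < a) (hb : 0 < b) :
    Tendsto (incompleteBeta a b) (𝓝[<] 1) (𝓝 (eulerBeta a b)) := by
  have h := continuousOn_incompleteBeta ha hb 1 (right_mem_Icc.2 zero_le_one)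
  refine Tendsto.mono_left h (nhdsWithin_le_of_mem ?_)
  exact mem_of_superset (Ioo_mem_nhdsLT one_pos) Ioo_subset_Icc_self

/-- Away from 1 the factor (1-x)^(b-1) is bounded, even for b < 1. Read backwards, the estimate
bounds the transport map from below near 0. -/
theorem incompleteBeta_le_rpow (ha : 0 < a) (hb : 0 < b) :
    ∃ C > 0, ∀ t ∈ Ioc (0 : ℝ) (1 / 2), incompleteBeta a b t ≤ C * t ^ a := by
  obtain ⟨M, hM⟩ : ∃ M, ∀ x ∈ Icc (0 : ℝ) (1 / 2), ‖(1 - x) ^ (b - 1)‖ ≤ M := by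
    refine isCompact_Icc.exists_bound_of_continuousOn ?_
    refine ContinuousOn.rpow_const (by fun_prop) fun x hx => Or.inl ?_
    linarith [hx.2]
  have hM0 : 0 ≤ M := (norm_nonneg _).trans (hM 0 (by norm_num))
  refine ⟨(M + 1) / a, by positivity, fun t ht => ?_⟩
  have hle : incompleteBeta a b t ≤ ∫ x in (0 : ℝ)..t, (M + 1) * x ^ (a - 1) := by
    refine intervalIntegral.integral_mono_on ht.1.le ?_ ?_ fun x hx => ?_
    · refine (intervalIntegrable_betaIntegrand ha hb).mono_set ?_
      rw [uIcc_of_le ht.1.le, uIcc_of_le zero_le_one]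
      exact Icc_subset_Icc_right (by linarith [ht.2])
    · exact (intervalIntegral.intervalIntegrable_rpow' (by linarith)).const_mul _
    · rw [mul_comm]
      have := (le_abs_self _).trans (hM x ⟨hx.1, hx.2.trans ht.2⟩)
      exact mul_le_mul_of_nonneg_right (by linarith) (Real.rpow_nonneg hx.1 _)
  refine hle.trans (le_of_eq ?_)
  rw [intervalIntegral.integral_const_mul, integral_rpow (Or.inl (by linarith)), sub_add_cancel,
    Real.zero_rpow ha.ne']
  ring

end incompleteBeta

/-! ### Regular densities, their primitives and the mass to be transported. -/

/-- The functions for which the half-line inequality is proved first: continuous, positive,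
bounded, and with bounded primitive. -/
structure IsRegularDensity (f : ℝ → ℝ) (L K : ℝ) : Prop where
  continuous : Continuous f
  pos : ∀ x, 0 < f x
  le : ∀ x, f x ≤ L
  primitive_le : ∀ x, 0 ≤ x → ∫ t in (0 : ℝ)..x, f t ≤ K

noncomputable section

/-- The primitive of `f` that vanishes at `0`. -/
def primitive (f : ℝ → ℝ) (x : ℝ) : ℝ := ∫ t in (0 : ℝ)..x, f t

/-- The integral over `(0, x)` of `F ^ q * t ^ (-s)`, where `F` is the primitive of `f`. -/
def primitiveMass (f : ℝ → ℝ) (q s x : ℝ) : ℝ := ∫ t in (0 : ℝ)..x, primitive f t ^ q * t ^ (-s)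

end

namespace IsRegularDensity

variable {f : ℝ → ℝ} {L K q s : ℝ}

theorem hasDerivAt_primitive (h : IsRegularDensity f L K) (x : ℝ) :
    HasDerivAt (primitive f) (f x) x :=
  intervalIntegral.integral_hasDerivAt_right (h.continuous.intervalIntegrable _ _)
    (h.continuous.stronglyMeasurableAtFilter _ _) h.continuous.continuousAt

theorem continuous_primitive (h : IsRegularDensity f L K) : Continuous (primitive f) :=
  continuous_iff_continuousAt.2 fun x => (h.hasDerivAt_primitive x).continuousAt

theorem primitive_pos (h : IsRegularDensity f L K) {x : ℝ} (hx : 0 < x) : 0 < primitive f x :=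
  intervalIntegral.intervalIntegral_pos_of_pos (h.continuous.intervalIntegrable _ _) h.pos hx

theorem primitive_le_mul (h : IsRegularDensity f L K) {x : ℝ} (hx : 0 ≤ x) :
    primitive f x ≤ L * x := by
  have := intervalIntegral.integral_mono_on hx (h.continuous.intervalIntegrable (μ := volume) _ _)
    (intervalIntegrable_const (c := L)) (fun t _ => h.le t)
  simpa [primitive, mul_comm] using this

theorem exists_mul_le_primitive (h : IsRegularDensity f L K) :
    ∃ m > 0, ∀ x ∈ Icc (0 : ℝ) 1, m * x ≤ primitive f x := by
  obtain ⟨y, -, hy⟩ := isCompact_Icc.exists_isMinOn (nonempty_Icc.2 (zero_le_one' ℝ))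
    h.continuous.continuousOn
  refine ⟨f y, h.pos y, fun x hx => ?_⟩
  have := intervalIntegral.integral_mono_on hx.1 (intervalIntegrable_const (c := f y))
    (h.continuous.intervalIntegrable (μ := volume) _ _) (fun t ht => hy ⟨ht.1, ht.2.trans hx.2⟩)
  simpa [primitive, mul_comm] using this

theorem bound_pos (h : IsRegularDensity f L K) : 0 < L := (h.pos 0).trans_le (h.le 0)

theorem continuousOn_massDensity (h : IsRegularDensity f L K) :
    ContinuousOn (fun t => primitive f t ^ q * t ^ (-s)) (Ioi 0) := by
  refine ContinuousOn.mul ?_ ?_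
  · exact h.continuous_primitive.continuousOn.rpow_const
      fun x hx => Or.inl (h.primitive_pos hx).ne'
  · exact continuousOn_id.rpow_const fun x hx => Or.inl (ne_of_gt hx)

theorem massDensity_pos (h : IsRegularDensity f L K) {x : ℝ} (hx : 0 < x) :
    0 < primitive f x ^ q * x ^ (-s) :=
  mul_pos (Real.rpow_pos_of_pos (h.primitive_pos hx) _) (Real.rpow_pos_of_pos hx _)

/-- Near 0 the bound F ≤ Lx makes the integrand O(t^(q-s)), integrable as s < q + 1; near ∞ the
bound F ≤ K makes it O(t^(-s)), integrable as s > 1. -/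
theorem integrableOn_massDensity (h : IsRegularDensity f L K) (hq : 0 < q) (hs : 1 < s)
    (hsq : s < q + 1) : IntegrableOn (fun t => primitive f t ^ q * t ^ (-s)) (Ioi 0) := by
  rw [← Ioc_union_Ioi_eq_Ioi zero_le_one]
  refine IntegrableOn.union ?_ ?_
  · have hint : IntegrableOn (fun t : ℝ => L ^ q * t ^ (q - s)) (Ioc 0 1) := by
      rw [← intervalIntegrable_iff_integrableOn_Ioc_of_le zero_le_one]
      exact (intervalIntegral.intervalIntegrable_rpow' (by linarith)).const_mul _
    refine Integrable.mono' hint ((h.continuousOn_massDensity.mono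
      Ioc_subset_Ioi_self).aestronglyMeasurable measurableSet_Ioc) ?_
    filter_upwards [ae_restrict_mem measurableSet_Ioc] with t ht
    rw [Real.norm_of_nonneg (h.massDensity_pos ht.1).le, sub_eq_add_neg, Real.rpow_add ht.1,
      ← mul_assoc, ← Real.mul_rpow h.bound_pos.le ht.1.le]
    exact mul_le_mul_of_nonneg_right (Real.rpow_le_rpow (h.primitive_pos ht.1).le
      (h.primitive_le_mul ht.1.le) hq.le) (Real.rpow_nonneg ht.1.le _)
  · have hint : IntegrableOn (fun t : ℝ => K ^ q * t ^ (-s)) (Ioi 1) :=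
      (integrableOn_Ioi_rpow_of_lt (by linarith) one_pos).const_mul _
    refine Integrable.mono' hint ((h.continuousOn_massDensity.mono
      (Ioi_subset_Ioi zero_le_one)).aestronglyMeasurable measurableSet_Ioi) ?_
    filter_upwards [ae_restrict_mem measurableSet_Ioi] with t ht
    have ht0 : 0 < t := one_pos.trans ht
    rw [Real.norm_of_nonneg (h.massDensity_pos ht0).le]
    exact mul_le_mul_of_nonneg_right (Real.rpow_le_rpow (h.primitive_pos ht0).le
      (h.primitive_le t ht0.le) hq.le) (Real.rpow_nonneg ht0.le _)

theorem intervalIntegrable_massDensity (h : IsRegularDensity f L K) (hq : 0 < q) (hs : 1 < s)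
    (hsq : s < q + 1) {x : ℝ} (hx : 0 ≤ x) :
    IntervalIntegrable (fun t => primitive f t ^ q * t ^ (-s)) volume 0 x := by
  rw [intervalIntegrable_iff_integrableOn_Ioc_of_le hx]
  exact (h.integrableOn_massDensity hq hs hsq).mono_set Ioc_subset_Ioi_self

theorem hasDerivAt_primitiveMass (h : IsRegularDensity f L K) (hq : 0 < q) (hs : 1 < s)
    (hsq : s < q + 1) {x : ℝ} (hx : 0 < x) :
    HasDerivAt (primitiveMass f q s) (primitive f x ^ q * x ^ (-s)) x :=
  intervalIntegral.integral_hasDerivAt_right (h.intervalIntegrable_massDensity hq hs hsq hx.le)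
    (h.continuousOn_massDensity.stronglyMeasurableAtFilter isOpen_Ioi x hx)
    (h.continuousOn_massDensity.continuousAt (Ioi_mem_nhds hx))

theorem tendsto_primitiveMass_atTop (h : IsRegularDensity f L K) (hq : 0 < q) (hs : 1 < s)
    (hsq : s < q + 1) : Tendsto (primitiveMass f q s) atTop
      (𝓝 (∫ t in Ioi (0 : ℝ), primitive f t ^ q * t ^ (-s))) :=
  intervalIntegral_tendsto_integral_Ioi 0 (h.integrableOn_massDensity hq hs hsq) tendsto_id

theorem tendsto_primitiveMass_zero (h : IsRegularDensity f L K) (hq : 0 < q) (hs : 1 < s)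
    (hsq : s < q + 1) : Tendsto (primitiveMass f q s) (𝓝[>] 0) (𝓝 0) := by
  have hc := intervalIntegral.continuousOn_primitive_interval'
    (h.intervalIntegrable_massDensity hq hs hsq zero_le_one) left_mem_uIcc
  rw [uIcc_of_le zero_le_one] at hc
  have h0 := hc 0 (left_mem_Icc.2 zero_le_one)
  rw [ContinuousWithinAt, intervalIntegral.integral_same] at h0
  refine Tendsto.mono_left h0 (nhdsWithin_le_of_mem ?_)
  exact mem_of_superset (Ioo_mem_nhdsGT one_pos) Ioo_subset_Icc_self

theorem exists_mul_rpow_le_primitiveMass (h : IsRegularDensity f L K) (hq : 0 < q) (hs : 1 < s)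
    (hsq : s < q + 1) :
    ∃ m > 0, ∀ x ∈ Ioc (0 : ℝ) 1, m * x ^ (q - s + 1) ≤ primitiveMass f q s x := by
  obtain ⟨m, hm, hle⟩ := h.exists_mul_le_primitive
  have hpos : 0 < q - s + 1 := by linarith
  refine ⟨m ^ q / (q - s + 1), by positivity, fun x hx => ?_⟩
  have hint : IntervalIntegrable (fun t : ℝ => m ^ q * t ^ (q - s)) volume 0 x :=
    (intervalIntegral.intervalIntegrable_rpow' (by linarith)).const_mul _
  have := intervalIntegral.integral_mono_on_of_le_Ioo hx.1.le hint
    (h.intervalIntegrable_massDensity hq hs hsq hx.1.le) fun t ht => by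
      rw [sub_eq_add_neg, Real.rpow_add ht.1, ← mul_assoc, ← Real.mul_rpow hm.le ht.1.le]
      exact mul_le_mul_of_nonneg_right (Real.rpow_le_rpow (mul_pos hm ht.1).le
        (hle t ⟨ht.1.le, ht.2.le.trans hx.2⟩) hq.le) (Real.rpow_nonneg ht.1.le _)
  refine le_trans (le_of_eq ?_) this
  rw [intervalIntegral.integral_const_mul, integral_rpow (Or.inl (by linarith)),
    Real.zero_rpow hpos.ne']
  ring

end IsRegularDensity

/-- Integration by parts as an inequality: the boundary term at 0 vanishes in the limit and the one
at ∞ has a favourable sign. Neither integral need be finite, since the comparison is made on compact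
intervals exhausting the half-line. -/
theorem lintegral_Ioi_le_of_hasDerivAt_sub {P A D : ℝ → ℝ}
    (hP : ∀ x > 0, HasDerivAt P (A x - D x) x) (hA : ContinuousOn A (Ioi 0))
    (hD : ContinuousOn D (Ioi 0)) (hA0 : ∀ x > 0, 0 ≤ A x) (hD0 : ∀ x > 0, 0 ≤ D x)
    (hP0 : ∀ x > 0, 0 ≤ P x) (hlim : Tendsto P (𝓝[>] 0) (𝓝 0)) :
    ∫⁻ x in Ioi (0 : ℝ), ENNReal.ofReal (D x) ≤ ∫⁻ x in Ioi (0 : ℝ), ENNReal.ofReal (A x) := by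
  have key : ∀ u v : ℝ, 0 < u → u ≤ v → ∫⁻ x in Ioc u v, ENNReal.ofReal (D x) ≤
      (∫⁻ x in Ioi (0 : ℝ), ENNReal.ofReal (A x)) + ENNReal.ofReal (P u) := by
    intro u v hu huv
    have hsub : Icc u v ⊆ Ioi 0 := fun x hx => hu.trans_le hx.1
    have hsub' : Ioc u v ⊆ Ioi 0 := Ioc_subset_Icc_self.trans hsub
    have hAi : IntervalIntegrable A volume u v :=
      (hA.mono hsub).intervalIntegrable_of_Icc huv
    have hDi : IntervalIntegrable D volume u v :=
      (hD.mono hsub).intervalIntegrable_of_Icc huv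
    have hftc := intervalIntegral.integral_eq_sub_of_hasDerivAt (a := u) (b := v)
      (f := P) (f' := fun x => A x - D x) (fun x hx => hP x (by
        rw [uIcc_of_le huv] at hx; exact hsub hx)) (hAi.sub hDi)
    rw [intervalIntegral.integral_sub hAi hDi] at hftc
    have hreal : ∫ x in u..v, D x ≤ (∫ x in u..v, A x) + P u := by
      linarith [hP0 v (hu.trans_le huv)]
    rw [intervalIntegral.integral_of_le huv, intervalIntegral.integral_of_le huv] at hreal
    have hAn : 0 ≤ᵐ[volume.restrict (Ioc u v)] A := by
      filter_upwards [ae_restrict_mem measurableSet_Ioc] with x hx using hA0 x (hsub' hx)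
    have hDn : 0 ≤ᵐ[volume.restrict (Ioc u v)] D := by
      filter_upwards [ae_restrict_mem measurableSet_Ioc] with x hx using hD0 x (hsub' hx)
    rw [intervalIntegrable_iff_integrableOn_Ioc_of_le huv] at hAi hDi
    rw [← ofReal_integral_eq_lintegral_ofReal hDi hDn]
    calc ENNReal.ofReal (∫ x in Ioc u v, D x)
        ≤ ENNReal.ofReal ((∫ x in Ioc u v, A x) + P u) := ENNReal.ofReal_le_ofReal hreal
      _ = ENNReal.ofReal (∫ x in Ioc u v, A x) + ENNReal.ofReal (P u) :=
          ENNReal.ofReal_add (integral_nonneg_of_ae hAn) (hP0 u hu)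
      _ = (∫⁻ x in Ioc u v, ENNReal.ofReal (A x)) + ENNReal.ofReal (P u) := by
          rw [ofReal_integral_eq_lintegral_ofReal hAi hAn]
      _ ≤ _ := by gcongr
  have key' : ∀ u v : ℝ, 0 < u → u ≤ v → ∫⁻ x in Ioc u v, ENNReal.ofReal (D x) ≤
      ∫⁻ x in Ioi (0 : ℝ), ENNReal.ofReal (A x) := by
    intro u v hu huv
    have ht : Tendsto (fun w => (∫⁻ x in Ioi (0 : ℝ), ENNReal.ofReal (A x)) +
        ENNReal.ofReal (P w)) (𝓝[>] 0) (𝓝 (∫⁻ x in Ioi (0 : ℝ), ENNReal.ofReal (A x))) := by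
      have := (ENNReal.tendsto_ofReal hlim).const_add (∫⁻ x in Ioi (0 : ℝ), ENNReal.ofReal (A x))
      simpa using this
    refine ge_of_tendsto ht ?_
    filter_upwards [Ioo_mem_nhdsGT hu] with w hw
    exact (lintegral_mono_set (Ioc_subset_Ioc_left hw.2.le)).trans
      (key w v hw.1 (hw.2.le.trans huv))
  have hU : Ioi (0 : ℝ) = ⋃ n : ℕ, Ioc (1 / ((n : ℝ) + 1)) ((n : ℝ) + 1) := by
    ext x
    simp only [mem_Ioi, mem_iUnion, mem_Ioc]
    refine ⟨fun hx => ?_, fun ⟨n, hn, _⟩ => lt_trans (by positivity) hn⟩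
    obtain ⟨n, hn⟩ := exists_nat_one_div_lt hx
    obtain ⟨k, hk⟩ := exists_nat_ge x
    refine ⟨max n k, lt_of_le_of_lt ?_ hn, ?_⟩
    · exact Nat.one_div_le_one_div (le_max_left n k)
    · have : (k : ℝ) ≤ (max n k : ℕ) := by exact_mod_cast le_max_right n k
      linarith
  rw [hU, setLIntegral_iUnion_of_directed, ← hU]
  · refine iSup_le fun n => key' _ _ (by positivity) ?_
    have : (0 : ℝ) ≤ n := n.cast_nonneg
    rw [div_le_iff₀ (by positivity)]
    nlinarith
  · refine Monotone.directed_le fun m n hmn => Ioc_subset_Ioc (Nat.one_div_le_one_div hmn) ?_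
    have : (m : ℝ) ≤ n := by exact_mod_cast hmn
    linarith

/-! ### Pointwise identities and AM-GM for the transport. -/

section exponents

variable {p q r α : ℝ}

theorem transport_amgm_identity (hp : 1 < p) (hr : 0 < r) (hq : q = p * (r + 1))
    (hα : α = (p - 1) * (r + 1)) {F x θ τ c : ℝ} (hF : 0 < F) (hx : 0 < x) (hθ : 0 < θ)
    (hτ : 0 < τ) (hc : 0 < c) :
    F ^ (α + 1) * (x ^ (-((α + 1) * ((p - 1) / p))) * (τ / θ) ^ ((p - 1) / p)) *
      (x⁻¹ ^ ((α + 1) / q) * (F ^ q * x ^ (-(α + 1)) / c /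
        (θ ^ (1 / r + 1 - 1) * τ ^ (α / r - 1)) / (r * (θ * τ))) ^ (r / q)) =
      (r * c) ^ (-(r / q)) * (F ^ q * x ^ (-(α + 1)) * θ⁻¹) := by
  -- Every positive base becomes an exponential, so the claim reduces to a rational identity between
  -- exponents. The number r is also an exponent, hence it is rewritten only where it is a base.
  obtain ⟨F, rfl⟩ := Real.range_exp.ge (mem_Ioi.2 hF)
  obtain ⟨x, rfl⟩ := Real.range_exp.ge (mem_Ioi.2 hx)
  obtain ⟨θ, rfl⟩ := Real.range_exp.ge (mem_Ioi.2 hθ)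
  obtain ⟨τ, rfl⟩ := Real.range_exp.ge (mem_Ioi.2 hτ)
  obtain ⟨c, rfl⟩ := Real.range_exp.ge (mem_Ioi.2 hc)
  obtain ⟨ρ, hρ⟩ := Real.range_exp.ge (mem_Ioi.2 hr)
  rw [show r * Real.exp c = Real.exp ρ * Real.exp c by rw [hρ],
    show r * (Real.exp θ * Real.exp τ) = Real.exp ρ * (Real.exp θ * Real.exp τ) by rw [hρ]]
  simp only [div_eq_mul_inv, ← Real.exp_mul, ← Real.exp_add, ← Real.exp_neg]
  congr 1
  have hp0 : p ≠ 0 := by linarith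
  have hr1 : r + 1 ≠ 0 := by linarith
  subst hq hα
  field_simp
  ring

/-- The weights (α+1)/q and r/q add up to 1 because q = α + 1 + r. They are chosen so that the
geometric mean cancels the powers in w and leaves the mass density times 1/θ. -/
theorem transport_amgm (hp : 1 < p) (hr : 0 < r) (hq : q = p * (r + 1))
    (hα : α = (p - 1) * (r + 1)) {F x θ τ c d : ℝ} (hF : 0 < F) (hx : 0 < x) (hθ : 0 < θ)
    (hτ : 0 < τ) (hc : 0 < c)
    (hd : d = F ^ q * x ^ (-(α + 1)) / c / (θ ^ (1 / r + 1 - 1) * τ ^ (α / r - 1))) :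
    α * ((r * c) ^ (-(r / q)) * (F ^ q * x ^ (-(α + 1)) * θ⁻¹)) ≤
      F ^ (α + 1) * (x ^ (-((α + 1) * ((p - 1) / p))) * (τ / θ) ^ ((p - 1) / p)) *
        ((p - 1) / p * ((α + 1) / x + d / (θ * τ))) := by
  have hp0 : 0 < p := by linarith
  have hα0 : 0 < α := by rw [hα]; exact mul_pos (by linarith) (by linarith)
  have hq0 : 0 < q := by rw [hq]; positivity
  have hqα : (p - 1) / p * q = α := by rw [hq, hα]; field_simp
  have hsum : (α + 1) / q + r / q = 1 := by
    rw [← add_div, div_eq_one_iff_eq hq0.ne', hq, hα]; ring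
  have hd0 : 0 < d := by rw [hd]; positivity
  have hm := Real.geom_mean_le_arith_mean2_weighted (w₁ := (α + 1) / q) (w₂ := r / q)
    (p₁ := x⁻¹) (p₂ := d / (r * (θ * τ))) (by positivity) (by positivity) (by positivity)
    (by positivity) hsum
  rw [← transport_amgm_identity hp hr hq hα hF hx hθ hτ hc, ← hd]
  calc _ = F ^ (α + 1) * (x ^ (-((α + 1) * ((p - 1) / p))) * (τ / θ) ^ ((p - 1) / p)) *
        (α * (x⁻¹ ^ ((α + 1) / q) * (d / (r * (θ * τ))) ^ (r / q))) := by ring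
    _ ≤ F ^ (α + 1) * (x ^ (-((α + 1) * ((p - 1) / p))) * (τ / θ) ^ ((p - 1) / p)) *
        (α * ((α + 1) / q * x⁻¹ + r / q * (d / (r * (θ * τ))))) := by gcongr
    _ = _ := by
        rw [← hqα]
        field_simp

/-- This is the second Hölder factor: α p* = q turns the power of F into that of the mass density,
and what remains is again θ' times a beta density at θ. -/
theorem transport_conjugate_identity (hp : 1 < p) (hr : 0 < r) (hq : q = p * (r + 1))
    (hα : α = (p - 1) * (r + 1)) {F x θ τ c d : ℝ} (hF : 0 < F) (hx : 0 < x) (hθ : 0 < θ)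
    (hτ : 0 < τ) (hc : 0 < c)
    (hd : d = F ^ q * x ^ (-(α + 1)) / c / (θ ^ (1 / r + 1 - 1) * τ ^ (α / r - 1))) :
    (F ^ α * (x ^ (-((α + 1) * ((p - 1) / p))) * (τ / θ) ^ ((p - 1) / p))) ^ (p / (p - 1)) =
      c * (d * (θ ^ (1 / r - 1) * τ ^ (α / r + 1 - 1))) := by
  subst hd
  obtain ⟨F, rfl⟩ := Real.range_exp.ge (mem_Ioi.2 hF)
  obtain ⟨x, rfl⟩ := Real.range_exp.ge (mem_Ioi.2 hx)
  obtain ⟨θ, rfl⟩ := Real.range_exp.ge (mem_Ioi.2 hθ)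
  obtain ⟨τ, rfl⟩ := Real.range_exp.ge (mem_Ioi.2 hτ)
  obtain ⟨c, rfl⟩ := Real.range_exp.ge (mem_Ioi.2 hc)
  simp only [div_eq_mul_inv, ← Real.exp_mul, ← Real.exp_add, ← Real.exp_neg]
  congr 1
  have hp0 : p ≠ 0 := by linarith
  have hp1 : p - 1 ≠ 0 := by linarith
  subst hq hα
  field_simp
  ring

theorem transport_density_identity {F x θ τ c d : ℝ} (hθ : 0 < θ) (hτ : 0 < τ) (hc : 0 < c)
    (hd : d = F ^ q * x ^ (-(α + 1)) / c / (θ ^ (1 / r + 1 - 1) * τ ^ (α / r - 1))) :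
    F ^ q * x ^ (-(α + 1)) * θ⁻¹ = c * (d * (θ ^ (1 / r - 1) * τ ^ (α / r - 1))) := by
  have h1 : θ ^ (1 / r + 1 - 1) = θ ^ (1 / r - 1) * θ := by
    rw [← Real.rpow_add_one hθ.ne']; congr 1; ring
  have h2 : 0 < θ ^ (1 / r - 1) := Real.rpow_pos_of_pos hθ _
  have h3 : 0 < τ ^ (α / r - 1) := Real.rpow_pos_of_pos hτ _
  rw [hd, h1]
  field_simp

end exponents

/-! ### Transport to the beta density and integration by parts. -/

noncomputable section

/-- The derivative of the map that transports `F ^ q * x ^ (-(α + 1)) dx / c` to the beta density,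
where `F` is the primitive of `f`. -/
def transportDeriv (f : ℝ → ℝ) (q r α c : ℝ) (θ : ℝ → ℝ) (x : ℝ) : ℝ :=
  primitive f x ^ q * x ^ (-(α + 1)) / c /
    (θ x ^ (1 / r + 1 - 1) * (1 - θ x) ^ (α / r - 1))

/-- The position of the transported mass, in the variable suited to integration by parts. -/
def transportWeight (p α : ℝ) (θ : ℝ → ℝ) (x : ℝ) : ℝ :=
  x ^ (-((α + 1) * ((p - 1) / p))) * ((1 - θ x) / θ x) ^ ((p - 1) / p)

end

/-- `θ` transports `F ^ q * x ^ (-(α + 1)) dx / c` on `(0, ∞)` monotonically to the beta density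
with parameters `1 / r + 1` and `α / r` on `(0, 1)`. -/
structure IsBlissTransport (f : ℝ → ℝ) (q r α c : ℝ) (θ : ℝ → ℝ) : Prop where
  mem : ∀ x > 0, θ x ∈ Ioo (0 : ℝ) 1
  mass : ∀ x > 0, incompleteBeta (1 / r + 1) (α / r) (θ x) = primitiveMass f q (α + 1) x / c
  hasDerivAt : ∀ x > 0, HasDerivAt θ (transportDeriv f q r α c θ x) x
  strictMonoOn : StrictMonoOn θ (Ioi 0)
  image : θ '' Ioi 0 = Ioo 0 1

namespace IsRegularDensity

variable {f : ℝ → ℝ} {L K : ℝ} {p q r α c : ℝ} {θ : ℝ → ℝ}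

theorem exists_isBlissTransport (h : IsRegularDensity f L K) (hr : 0 < r) (hα : 0 < α)
    (hq : q = α + 1 + r) (hc : 0 < c)
    (hcm : ∫ t in Ioi (0 : ℝ), primitive f t ^ q * t ^ (-(α + 1)) =
      c * eulerBeta (1 / r + 1) (α / r)) :
    ∃ θ, IsBlissTransport f q r α c θ := by
  have hq0 : 0 < q := by linarith
  have hs : 1 < α + 1 := by linarith
  have hsq : α + 1 < q + 1 := by linarith
  have ha : 0 < 1 / r + 1 := by positivity
  have hb : 0 < α / r := by positivity
  obtain ⟨θ, h1, h2, h3, h4, h5⟩ := exists_monotone_transport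
    (Z := fun x => primitiveMass f q (α + 1) x / c)
    (ζ := fun x => primitive f x ^ q * x ^ (-(α + 1)) / c)
    (I := incompleteBeta (1 / r + 1) (α / r))
    (β := fun t => t ^ (1 / r + 1 - 1) * (1 - t) ^ (α / r - 1))
    (m := eulerBeta (1 / r + 1) (α / r))
    (fun x hx => (h.hasDerivAt_primitiveMass hq0 hs hsq hx).div_const c)
    (fun x hx => div_pos (h.massDensity_pos hx) hc)
    (by simpa using (h.tendsto_primitiveMass_zero hq0 hs hsq).div_const c)
    (by
      have := (h.tendsto_primitiveMass_atTop hq0 hs hsq).div_const c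
      rwa [hcm, mul_div_cancel_left₀ _ hc.ne'] at this)
    (fun t ht => hasDerivAt_incompleteBeta ha hb ht)
    (fun t ht => mul_pos (Real.rpow_pos_of_pos ht.1 _)
      (Real.rpow_pos_of_pos (by linarith [ht.2]) _))
    (tendsto_incompleteBeta_zero ha hb) (tendsto_incompleteBeta_one ha hb)
  exact ⟨θ, h1, h2, h3, h4, h5⟩

end IsRegularDensity

namespace IsBlissTransport

variable {f : ℝ → ℝ} {L K : ℝ} {p q r α c : ℝ} {θ : ℝ → ℝ}

theorem continuousOn (hθ : IsBlissTransport f q r α c θ) : ContinuousOn θ (Ioi 0) :=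
  fun x hx => (hθ.hasDerivAt x hx).continuousAt.continuousWithinAt

theorem one_sub_pos (hθ : IsBlissTransport f q r α c θ) {x : ℝ} (hx : 0 < x) : 0 < 1 - θ x := by
  linarith [(hθ.mem x hx).2]

theorem transportDeriv_pos (hθ : IsBlissTransport f q r α c θ) (h : IsRegularDensity f L K)
    (hc : 0 < c) {x : ℝ} (hx : 0 < x) : 0 < transportDeriv f q r α c θ x :=
  div_pos (div_pos (h.massDensity_pos hx) hc) (mul_pos (Real.rpow_pos_of_pos (hθ.mem x hx).1 _)
    (Real.rpow_pos_of_pos (hθ.one_sub_pos hx) _))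

theorem transportWeight_pos (hθ : IsBlissTransport f q r α c θ) {x : ℝ} (hx : 0 < x) :
    0 < transportWeight p α θ x :=
  mul_pos (Real.rpow_pos_of_pos hx _)
    (Real.rpow_pos_of_pos (div_pos (hθ.one_sub_pos hx) (hθ.mem x hx).1) _)

theorem continuousOn_transportDeriv (hθ : IsBlissTransport f q r α c θ)
    (h : IsRegularDensity f L K) :
    ContinuousOn (transportDeriv f q r α c θ) (Ioi 0) := by
  refine ContinuousOn.div (h.continuousOn_massDensity.div_const c) (ContinuousOn.mul ?_ ?_) ?_
  · exact hθ.continuousOn.rpow_const fun x hx => Or.inl (hθ.mem x hx).1.ne'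
  · exact (continuousOn_const.sub hθ.continuousOn).rpow_const
      fun x hx => Or.inl (hθ.one_sub_pos hx).ne'
  · exact fun x hx => (mul_pos (Real.rpow_pos_of_pos (hθ.mem x hx).1 _)
      (Real.rpow_pos_of_pos (hθ.one_sub_pos hx) _)).ne'

theorem continuousOn_transportWeight (hθ : IsBlissTransport f q r α c θ) :
    ContinuousOn (transportWeight p α θ) (Ioi 0) := by
  refine ContinuousOn.mul (continuousOn_id.rpow_const fun x hx => Or.inl (ne_of_gt hx)) ?_
  refine ContinuousOn.rpow_const ((continuousOn_const.sub hθ.continuousOn).div hθ.continuousOn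
    fun x hx => (hθ.mem x hx).1.ne') fun x hx => Or.inl ?_
  exact (div_pos (hθ.one_sub_pos hx) (hθ.mem x hx).1).ne'

theorem hasDerivAt_transportWeight (hθ : IsBlissTransport f q r α c θ) {x : ℝ} (hx : 0 < x) :
    HasDerivAt (transportWeight p α θ) (-(transportWeight p α θ x * ((p - 1) / p *
      ((α + 1) / x + transportDeriv f q r α c θ x / (θ x * (1 - θ x)))))) x := by
  have hd := hθ.hasDerivAt x hx
  have h0 := (hθ.mem x hx).1
  have h1 := hθ.one_sub_pos hx
  have hx' := Real.hasDerivAt_rpow_const (x := x) (p := -((α + 1) * ((p - 1) / p)))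
    (Or.inl hx.ne')
  have hq := ((hd.const_sub 1).div hd h0.ne').rpow_const (p := (p - 1) / p)
    (Or.inl (div_pos h1 h0).ne')
  refine (hx'.mul hq).congr_deriv ?_
  simp only [Pi.div_apply]
  rw [Real.rpow_sub_one hx.ne', Real.rpow_sub_one (div_pos h1 h0).ne', transportWeight]
  field_simp
  ring

/-- The weight blows up at 0 through both x and θ. Comparing the mass with the incomplete beta
integral gives θ ≥ const · x^r; with F ≤ Lx the total exponent of x is α + 1 - (α+1+r)/p* = 1. -/
theorem tendsto_boundaryTerm (hθ : IsBlissTransport f q r α c θ) (h : IsRegularDensity f L K)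
    (hp : 1 < p) (hr : 0 < r) (hq : q = p * (r + 1)) (hα : α = (p - 1) * (r + 1)) (hc : 0 < c) :
    Tendsto (fun x => primitive f x ^ (α + 1) * transportWeight p α θ x) (𝓝[>] 0) (𝓝 0) := by
  have hα0 : 0 < α := by rw [hα]; exact mul_pos (by linarith) (by linarith)
  have hqs : q = α + 1 + r := by rw [hq, hα]; ring
  have hκ : 0 < (p - 1) / p := div_pos (by linarith) (by linarith)
  obtain ⟨C, hC, hCle⟩ := incompleteBeta_le_rpow (a := 1 / r + 1) (b := α / r) (by positivity)
    (by positivity)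
  obtain ⟨m, hm, hmle⟩ := h.exists_mul_rpow_le_primitiveMass (q := q) (s := α + 1)
    (by linarith) (by linarith) (by linarith)
  -- To the left of this point θ stays below 1/2, where the power bound for the incomplete beta
  -- integral is available.
  obtain ⟨x₀, hx₀, hθ₀⟩ : (1 / 2 : ℝ) ∈ θ '' Ioi 0 := by rw [hθ.image]; norm_num
  set M : ℝ := m / (c * C) with hMdef
  have hM : 0 < M := by positivity
  have hlow : ∀ x ∈ Ioo 0 (min x₀ 1), (M * x ^ (r + 1)) ^ (r / (r + 1)) ≤ θ x := by
    intro x hx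
    have hx1 : x ≤ 1 := (hx.2.trans_le (min_le_right _ _)).le
    have hθx : θ x ≤ 1 / 2 := by
      rw [← hθ₀]
      exact (hθ.strictMonoOn hx.1 hx₀ (hx.2.trans_le (min_le_left _ _))).le
    have h0 := (hθ.mem x hx.1).1
    have e1 := hCle (θ x) ⟨h0, hθx⟩
    have e2 := hmle x ⟨hx.1, hx1⟩
    rw [hθ.mass x hx.1] at e1
    rw [show q - (α + 1) + 1 = r + 1 by rw [hqs]; ring] at e2
    have e3 : M * x ^ (r + 1) ≤ θ x ^ (1 / r + 1) := by
      rw [div_le_iff₀ hc] at e1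
      rw [hMdef, div_mul_eq_mul_div, div_le_iff₀ (by positivity)]
      calc m * x ^ (r + 1) ≤ _ := e2
        _ ≤ _ := e1
        _ = _ := by ring
    have hxn : 0 ≤ x ^ (r + 1) := Real.rpow_nonneg hx.1.le _
    calc (M * x ^ (r + 1)) ^ (r / (r + 1)) ≤ (θ x ^ (1 / r + 1)) ^ (r / (r + 1)) :=
          Real.rpow_le_rpow (by positivity) e3 (by positivity)
      _ = θ x := by
          rw [← Real.rpow_mul h0.le, show (1 / r + 1) * (r / (r + 1)) = 1 by field_simp; ring,
            Real.rpow_one]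
  set D : ℝ := L ^ (α + 1) * (M ^ (r / (r + 1))) ^ (-((p - 1) / p)) with hD
  have hbound : ∀ x ∈ Ioo 0 (min x₀ 1),
      primitive f x ^ (α + 1) * transportWeight p α θ x ≤ D * x := by
    intro x hx
    have hx0 : 0 < x := hx.1
    have h0 := (hθ.mem x hx.1).1
    have hL := h.bound_pos
    have e1 : primitive f x ^ (α + 1) ≤ (L * x) ^ (α + 1) :=
      Real.rpow_le_rpow (h.primitive_pos hx.1).le (h.primitive_le_mul hx.1.le) (by linarith)
    have e2 : ((1 - θ x) / θ x) ^ ((p - 1) / p) ≤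
        ((M * x ^ (r + 1)) ^ (r / (r + 1))) ^ (-((p - 1) / p)) := by
      rw [Real.rpow_neg (by positivity), ← Real.inv_rpow (by positivity)]
      refine Real.rpow_le_rpow (div_pos (hθ.one_sub_pos hx.1) h0).le ?_ hκ.le
      calc (1 - θ x) / θ x ≤ 1 / θ x := by gcongr; linarith
        _ = (θ x)⁻¹ := one_div _
        _ ≤ _ := inv_anti₀ (by positivity) (hlow x hx)
    calc primitive f x ^ (α + 1) * transportWeight p α θ x
        ≤ (L * x) ^ (α + 1) * (x ^ (-((α + 1) * ((p - 1) / p))) *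
          ((M * x ^ (r + 1)) ^ (r / (r + 1))) ^ (-((p - 1) / p))) := by
          rw [transportWeight]
          have := (Real.rpow_nonneg (div_pos (hθ.one_sub_pos hx.1) h0).le ((p - 1) / p))
          gcongr
      _ = D * x := by
          rw [hD]
          clear_value M
          clear hlow e1 e2 hD
          obtain ⟨x, rfl⟩ := Real.range_exp.ge (mem_Ioi.2 hx0)
          obtain ⟨l, hl⟩ := Real.range_exp.ge (mem_Ioi.2 hL)
          obtain ⟨μ, hμ⟩ := Real.range_exp.ge (mem_Ioi.2 hM)
          rw [← hl, ← hμ]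
          simp only [← Real.exp_mul, ← Real.exp_add]
          congr 1
          have hp0 : p ≠ 0 := by linarith
          have hr1 : r + 1 ≠ 0 := by linarith
          rw [hα]
          field_simp
          ring
  have hev : ∀ᶠ x in 𝓝[>] (0 : ℝ), x ∈ Ioo 0 (min x₀ 1) :=
    Ioo_mem_nhdsGT (lt_min hx₀ one_pos)
  refine squeeze_zero' ?_ (hev.mono hbound) ?_
  · filter_upwards [hev] with x hx
    exact (mul_pos (Real.rpow_pos_of_pos (h.primitive_pos hx.1) _)
      (hθ.transportWeight_pos hx.1)).le
  · have : Tendsto (fun x : ℝ => D * x) (𝓝 0) (𝓝 (D * 0)) := tendsto_id.const_mul D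
    rw [mul_zero] at this
    exact this.mono_left nhdsWithin_le_nhds

theorem lintegral_parts_le (hθ : IsBlissTransport f q r α c θ) (h : IsRegularDensity f L K)
    (hp : 1 < p) (hr : 0 < r) (hq : q = p * (r + 1)) (hα : α = (p - 1) * (r + 1)) (hc : 0 < c) :
    ∫⁻ x in Ioi (0 : ℝ), ENNReal.ofReal (primitive f x ^ (α + 1) * transportWeight p α θ x *
        ((p - 1) / p * ((α + 1) / x + transportDeriv f q r α c θ x / (θ x * (1 - θ x))))) ≤
      ∫⁻ x in Ioi (0 : ℝ), ENNReal.ofReal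
        ((α + 1) * (f x * (primitive f x ^ α * transportWeight p α θ x))) := by
  have hα0 : 0 < α := by rw [hα]; exact mul_pos (by linarith) (by linarith)
  have hκ : 0 < (p - 1) / p := div_pos (by linarith) (by linarith)
  have hFc : ∀ β : ℝ, ContinuousOn (fun x => primitive f x ^ β) (Ioi 0) := fun β =>
    h.continuous_primitive.continuousOn.rpow_const fun x hx => Or.inl (h.primitive_pos hx).ne'
  refine lintegral_Ioi_le_of_hasDerivAt_sub
    (P := fun x => primitive f x ^ (α + 1) * transportWeight p α θ x) (fun x hx => ?_) ?_ ?_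
    (fun x hx => ?_) (fun x hx => ?_) (fun x hx => ?_)
    (hθ.tendsto_boundaryTerm h hp hr hq hα hc)
  · have hF := (h.hasDerivAt_primitive x).rpow_const (p := α + 1)
      (Or.inl (h.primitive_pos hx).ne')
    refine (hF.mul (hθ.hasDerivAt_transportWeight (p := p) hx)).congr_deriv ?_
    rw [add_sub_cancel_right]
    ring
  · exact continuousOn_const.mul (h.continuous.continuousOn.mul
      ((hFc α).mul hθ.continuousOn_transportWeight))
  · refine ((hFc _).mul hθ.continuousOn_transportWeight).mul (continuousOn_const.mul
      (ContinuousOn.add ?_ ?_))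
    · exact continuousOn_const.div continuousOn_id fun x hx => ne_of_gt hx
    · exact (hθ.continuousOn_transportDeriv h).div (hθ.continuousOn.mul
        (continuousOn_const.sub hθ.continuousOn))
        fun x hx => (mul_pos (hθ.mem x hx).1 (hθ.one_sub_pos hx)).ne'
  · have h1 := h.pos x
    have h2 := h.primitive_pos hx
    have h3 := hθ.transportWeight_pos (p := p) hx
    positivity
  · have h1 := (hθ.mem x hx).1
    have h2 := h.primitive_pos hx
    have h3 := hθ.transportWeight_pos (p := p) hx
    have h4 := hθ.one_sub_pos hx
    have h5 := hθ.transportDeriv_pos h hc hx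
    have h6 : 0 < x := hx
    positivity
  · have h2 := h.primitive_pos hx
    have h3 := hθ.transportWeight_pos (p := p) hx
    positivity

theorem lintegral_comp (hθ : IsBlissTransport f q r α c θ) (h : IsRegularDensity f L K)
    (hc : 0 < c) (g : ℝ → ℝ) :
    ∫⁻ x in Ioi (0 : ℝ), ENNReal.ofReal (transportDeriv f q r α c θ x * g (θ x)) =
      ∫⁻ t in Ioo (0 : ℝ) 1, ENNReal.ofReal (g t) := by
  rw [← hθ.image, lintegral_image_eq_lintegral_abs_deriv_mul measurableSet_Ioi
    (fun x hx => (hθ.hasDerivAt x hx).hasDerivWithinAt) hθ.strictMonoOn.injOn]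
  refine setLIntegral_congr_fun measurableSet_Ioi fun x hx => ?_
  have hd := (hθ.transportDeriv_pos h hc hx).le
  rw [ENNReal.ofReal_mul hd, abs_of_nonneg hd]

end IsBlissTransport

/-! ### The sharp inequality for regular densities. -/

theorem sharpFactor_identity {p q r n B c : ℝ} (hp : 1 < p) (hr : 0 < r) (hq : q = p * (r + 1))
    (hB : 0 < B) (hc : 0 < c)
    (h : (r * c) ^ (-(r / q)) * (c * B) ≤ n * (c * B) ^ (1 / (p / (p - 1)))) :
    (c * B) ^ (1 / q) ≤ (r / B) ^ (1 / p - 1 / q) * n := by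
  have hid : (c * B) ^ (1 / q) = (r / B) ^ (1 / p - 1 / q) *
      ((r * c) ^ (-(r / q)) * (c * B)) * (c * B) ^ (-(1 / (p / (p - 1)))) := by
    obtain ⟨ρ, hρ⟩ := Real.range_exp.ge (mem_Ioi.2 hr)
    obtain ⟨B, rfl⟩ := Real.range_exp.ge (mem_Ioi.2 hB)
    obtain ⟨c, rfl⟩ := Real.range_exp.ge (mem_Ioi.2 hc)
    rw [show r / Real.exp B = Real.exp ρ / Real.exp B by rw [hρ],
      show r * Real.exp c = Real.exp ρ * Real.exp c by rw [hρ]]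
    simp only [div_eq_mul_inv, ← Real.exp_mul, ← Real.exp_add, ← Real.exp_neg]
    congr 1
    have hp0 : p ≠ 0 := by linarith
    have hp1 : p - 1 ≠ 0 := by linarith
    have hr1 : r + 1 ≠ 0 := by linarith
    subst hq
    field_simp
    ring
  have hcB : 0 < c * B := mul_pos hc hB
  have hrB : 0 < r / B := div_pos hr hB
  rw [hid]
  calc _ ≤ (r / B) ^ (1 / p - 1 / q) * (n * (c * B) ^ (1 / (p / (p - 1)))) *
        (c * B) ^ (-(1 / (p / (p - 1)))) := by gcongr
    _ = (r / B) ^ (1 / p - 1 / q) * n * ((c * B) ^ (1 / (p / (p - 1))) *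
        (c * B) ^ (-(1 / (p / (p - 1))))) := by ring
    _ = _ := by rw [← Real.rpow_add hcB, add_neg_cancel, Real.rpow_zero, mul_one]

namespace IsRegularDensity

variable {f : ℝ → ℝ} {L K : ℝ} {p q r α : ℝ}

theorem lintegral_massDensity (h : IsRegularDensity f L K) (hq : 0 < q) (hα : 0 < α)
    (hαq : α < q) :
    ∫⁻ x in Ioi (0 : ℝ), ENNReal.ofReal (primitive f x ^ q * x ^ (-(α + 1))) =
      ENNReal.ofReal (∫ x in Ioi (0 : ℝ), primitive f x ^ q * x ^ (-(α + 1))) := by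
  rw [ofReal_integral_eq_lintegral_ofReal
    (h.integrableOn_massDensity hq (by linarith) (by linarith))]
  filter_upwards [ae_restrict_mem measurableSet_Ioi] with x hx using (h.massDensity_pos hx).le

theorem integral_massDensity_pos (h : IsRegularDensity f L K) (hq : 0 < q) (hα : 0 < α)
    (hαq : α < q) : 0 < ∫ x in Ioi (0 : ℝ), primitive f x ^ q * x ^ (-(α + 1)) := by
  rw [setIntegral_pos_iff_support_of_nonneg_ae]
  · have : Ioi (0 : ℝ) ⊆ Function.support fun x => primitive f x ^ q * x ^ (-(α + 1)) :=
      fun x hx => (h.massDensity_pos hx).ne'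
    rw [inter_eq_self_of_subset_right this, Real.volume_Ioi]
    exact ENNReal.zero_lt_top
  · filter_upwards [ae_restrict_mem measurableSet_Ioi] with x hx using (h.massDensity_pos hx).le
  · exact h.integrableOn_massDensity hq (by linarith) (by linarith)

theorem lintegral_mul_le (h : IsRegularDensity f L K) (hp : 1 < p) {g : ℝ → ℝ}
    (hg : ContinuousOn g (Ioi 0)) (hg0 : ∀ x > 0, 0 ≤ g x) :
    ∫⁻ x in Ioi (0 : ℝ), ENNReal.ofReal (f x * g x) ≤
      (∫⁻ x in Ioi (0 : ℝ), ENNReal.ofReal (f x ^ p)) ^ (1 / p) *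
        (∫⁻ x in Ioi (0 : ℝ), ENNReal.ofReal (g x ^ (p / (p - 1)))) ^ (1 / (p / (p - 1))) := by
  have hconj : p.HolderConjugate (p / (p - 1)) := Real.HolderConjugate.conjExponent hp
  have hH := ENNReal.lintegral_mul_le_Lp_mul_Lq (volume.restrict (Ioi (0 : ℝ))) hconj
    (f := fun x => ENNReal.ofReal (f x)) (g := fun x => ENNReal.ofReal (g x))
    h.continuous.measurable.ennreal_ofReal.aemeasurable
    (hg.aemeasurable measurableSet_Ioi).ennreal_ofReal
  refine (le_of_eq ?_).trans (hH.trans (le_of_eq ?_))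
  · refine lintegral_congr fun x => ?_
    rw [Pi.mul_apply, ENNReal.ofReal_mul (h.pos x).le]
  · congr 2
    · refine lintegral_congr fun x => ?_
      rw [ENNReal.ofReal_rpow_of_nonneg (h.pos x).le (by linarith)]
    · refine setLIntegral_congr_fun measurableSet_Ioi fun x hx => ?_
      exact ENNReal.ofReal_rpow_of_nonneg (hg0 x hx) hconj.symm.nonneg

/-- AM-GM produces B(1/r, α/r) and Hölder produces B(1/r, α/r+1), while the mass is measured by
B(1/r+1, α/r). The recursions of the beta function express all three through the second one. -/
theorem bliss_of_lt (h : IsRegularDensity f L K) (hp : 1 < p) (hr : 0 < r)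
    (hq : q = p * (r + 1)) (hα : α = (p - 1) * (r + 1)) :
    (∫⁻ x in Ioi (0 : ℝ),
        ENNReal.ofReal (α * (primitive f x ^ q * x ^ (-(α + 1))))) ^ (1 / q) ≤
      ENNReal.ofReal ((r / eulerBeta (1 / r) (α / r + 1)) ^ (1 / p - 1 / q)) *
        (∫⁻ x in Ioi (0 : ℝ), ENNReal.ofReal (f x ^ p)) ^ (1 / p) := by
  have hα0 : 0 < α := by rw [hα]; exact mul_pos (by linarith) (by linarith)
  have hqs : q = α + 1 + r := by rw [hq, hα]; ring
  have hq0 : 0 < q := by linarith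
  have hr1 : 0 < 1 / r := by positivity
  have hαr : 0 < α / r := by positivity
  have hB := eulerBeta_pos hr1 (b := α / r + 1) (by positivity)
  have hB₁ := eulerBeta_pos hr1 hαr
  have hB₂ := eulerBeta_pos (a := 1 / r + 1) (by positivity) hαr
  have hB₁e : α * eulerBeta (1 / r) (α / r) = (α + 1) * eulerBeta (1 / r) (α / r + 1) := by
    rw [eulerBeta_add_one_right hr1 hαr]
    field_simp
    ring
  have hB₂e : α * eulerBeta (1 / r + 1) (α / r) = eulerBeta (1 / r) (α / r + 1) := by
    rw [eulerBeta_add_one_left hr1 hαr, eulerBeta_add_one_right hr1 hαr]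
    field_simp
  set B := eulerBeta (1 / r) (α / r + 1) with hBdef
  have hm := h.integral_massDensity_pos hq0 hα0 (by linarith)
  set m := ∫ x in Ioi (0 : ℝ), primitive f x ^ q * x ^ (-(α + 1)) with hmdef
  -- This normalisation gives source and target equal mass, and makes the integral to be estimated,
  -- α m, equal to c B.
  set c := m / eulerBeta (1 / r + 1) (α / r) with hcdef
  have hc : 0 < c := div_pos hm hB₂
  have hmc : m = c * eulerBeta (1 / r + 1) (α / r) := (div_mul_cancel₀ m hB₂.ne').symm
  have hαm : α * m = c * B := by rw [hmc, ← hB₂e]; ring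
  have hL : ∫⁻ x in Ioi (0 : ℝ), ENNReal.ofReal (α * (primitive f x ^ q * x ^ (-(α + 1)))) =
      ENNReal.ofReal (c * B) := by
    simp_rw [ENNReal.ofReal_mul hα0.le]
    rw [lintegral_const_mul' _ _ ENNReal.ofReal_ne_top,
      h.lintegral_massDensity hq0 hα0 (by linarith), ← ENNReal.ofReal_mul hα0.le, hαm]
  obtain ⟨θ, hθ⟩ := h.exists_isBlissTransport hr hα0 hqs hc hmc
  have hrc : 0 < (r * c) ^ (-(r / q)) := Real.rpow_pos_of_pos (mul_pos hr hc) _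
  have hlow : ENNReal.ofReal ((α + 1) * ((r * c) ^ (-(r / q)) * (c * B))) ≤
      ∫⁻ x in Ioi (0 : ℝ), ENNReal.ofReal (primitive f x ^ (α + 1) * transportWeight p α θ x *
        ((p - 1) / p * ((α + 1) / x + transportDeriv f q r α c θ x / (θ x * (1 - θ x))))) := by
    have e : (α + 1) * ((r * c) ^ (-(r / q)) * (c * B)) =
        (α * (r * c) ^ (-(r / q)) * c) * eulerBeta (1 / r) (α / r) := by
      linear_combination (-(r * c) ^ (-(r / q)) * c) * hB₁e
    rw [e, ENNReal.ofReal_mul (by positivity), ← lintegral_betaIntegrand hr1 hαr,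
      ← hθ.lintegral_comp h hc (fun t => t ^ (1 / r - 1) * (1 - t) ^ (α / r - 1)),
      ← lintegral_const_mul' _ _ ENNReal.ofReal_ne_top]
    refine setLIntegral_mono' measurableSet_Ioi fun x hx => ?_
    rw [← ENNReal.ofReal_mul (by positivity)]
    refine ENNReal.ofReal_le_ofReal (le_trans (le_of_eq ?_)
      (transport_amgm hp hr hq hα (h.primitive_pos hx) hx (hθ.mem x hx).1 (hθ.one_sub_pos hx)
        hc (d := transportDeriv f q r α c θ x) rfl))
    rw [transport_density_identity (hθ.mem x hx).1 (hθ.one_sub_pos hx) hc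
      (d := transportDeriv f q r α c θ x) rfl]
    ring
  have hupp : ∫⁻ x in Ioi (0 : ℝ), ENNReal.ofReal
        ((α + 1) * (f x * (primitive f x ^ α * transportWeight p α θ x))) ≤
      ENNReal.ofReal (α + 1) * ((∫⁻ x in Ioi (0 : ℝ), ENNReal.ofReal (f x ^ p)) ^ (1 / p) *
        ENNReal.ofReal (c * B) ^ (1 / (p / (p - 1)))) := by
    simp_rw [ENNReal.ofReal_mul (show 0 ≤ α + 1 by linarith)]
    rw [lintegral_const_mul' _ _ ENNReal.ofReal_ne_top]
    gcongr
    refine (h.lintegral_mul_le hp (g := fun x => primitive f x ^ α * transportWeight p α θ x)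
      ((h.continuous_primitive.continuousOn.rpow_const
        fun x hx => Or.inl (h.primitive_pos hx).ne').mul hθ.continuousOn_transportWeight)
      fun x hx => (mul_pos (Real.rpow_pos_of_pos (h.primitive_pos hx) _)
        (hθ.transportWeight_pos hx)).le).trans (le_of_eq ?_)
    congr 2
    rw [ENNReal.ofReal_mul hc.le, hBdef, ← lintegral_betaIntegrand hr1 (b := α / r + 1)
      (by positivity),
      ← hθ.lintegral_comp h hc (fun t => t ^ (1 / r - 1) * (1 - t) ^ (α / r + 1 - 1)),
      ← lintegral_const_mul' _ _ ENNReal.ofReal_ne_top]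
    refine setLIntegral_congr_fun measurableSet_Ioi fun x hx => ?_
    rw [← ENNReal.ofReal_mul hc.le, transportWeight,
      transport_conjugate_identity hp hr hq hα (h.primitive_pos hx) hx (hθ.mem x hx).1
        (hθ.one_sub_pos hx) hc (d := transportDeriv f q r α c θ x) rfl]
  have hmain := hlow.trans ((hθ.lintegral_parts_le h hp hr hq hα hc).trans hupp)
  have hcB : 0 < c * B := mul_pos hc hB
  have hrB : 0 < (r / B) ^ (1 / p - 1 / q) := Real.rpow_pos_of_pos (div_pos hr hB) _
  rw [hL, ENNReal.ofReal_rpow_of_nonneg hcB.le (by positivity)]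
  set N := (∫⁻ x in Ioi (0 : ℝ), ENNReal.ofReal (f x ^ p)) ^ (1 / p) with hN
  clear_value N
  rcases eq_or_ne N ∞ with rfl | hNtop
  · rw [ENNReal.mul_top (by simpa using hrB)]
    exact le_top
  · rw [← ENNReal.ofReal_toReal hNtop] at hmain ⊢
    have hκ : 0 ≤ 1 / (p / (p - 1)) := by
      have : 0 < p - 1 := by linarith
      positivity
    rw [ENNReal.ofReal_rpow_of_nonneg hcB.le hκ, ← ENNReal.ofReal_mul ENNReal.toReal_nonneg,
      ← ENNReal.ofReal_mul (by linarith), ENNReal.ofReal_le_ofReal_iff (by positivity),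
      mul_le_mul_iff_right₀ (by linarith)] at hmain
    rw [← ENNReal.ofReal_mul hrB.le]
    exact ENNReal.ofReal_le_ofReal (sharpFactor_identity hp hr hq hB hc hmain)

/-- The weight x^(-(p-1)) replaces the transported one. Hölder reproduces the left-hand integral J
to the power 1/p*. -/
theorem hardy (h : IsRegularDensity f L K) (hp : 1 < p) :
    (∫⁻ x in Ioi (0 : ℝ),
        ENNReal.ofReal ((p - 1) * (primitive f x ^ p * x ^ (-(p - 1 + 1))))) ^ (1 / p) ≤
      ENNReal.ofReal ((p - 1) ^ (1 / p) * (p / (p - 1))) *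
        (∫⁻ x in Ioi (0 : ℝ), ENNReal.ofReal (f x ^ p)) ^ (1 / p) := by
  have hp0 : 0 < p := by linarith
  have hp1 : 0 < p - 1 := by linarith
  have hJ := h.integral_massDensity_pos (q := p) (α := p - 1) hp0 hp1 (by linarith)
  have hJe := h.lintegral_massDensity (q := p) (α := p - 1) hp0 hp1 (by linarith)
  set J := ∫ x in Ioi (0 : ℝ), primitive f x ^ p * x ^ (-(p - 1 + 1)) with hJdef
  have hL : ∫⁻ x in Ioi (0 : ℝ),
      ENNReal.ofReal ((p - 1) * (primitive f x ^ p * x ^ (-(p - 1 + 1)))) =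
      ENNReal.ofReal ((p - 1) * J) := by
    simp_rw [ENNReal.ofReal_mul hp1.le]
    rw [lintegral_const_mul' _ _ ENNReal.ofReal_ne_top, hJe, ← ENNReal.ofReal_mul hp1.le]
  have hFc : ∀ β : ℝ, ContinuousOn (fun x => primitive f x ^ β) (Ioi 0) := fun β =>
    h.continuous_primitive.continuousOn.rpow_const fun x hx => Or.inl (h.primitive_pos hx).ne'
  have hxc : ∀ β : ℝ, ContinuousOn (fun x : ℝ => x ^ β) (Ioi 0) := fun β =>
    continuousOn_id.rpow_const fun x hx => Or.inl (ne_of_gt hx)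
  have hparts : ∫⁻ x in Ioi (0 : ℝ),
      ENNReal.ofReal ((p - 1) * (primitive f x ^ p * x ^ (-(p - 1 + 1)))) ≤
      ∫⁻ x in Ioi (0 : ℝ), ENNReal.ofReal
        (p * (f x * (primitive f x ^ (p - 1) * x ^ (-(p - 1))))) := by
    refine lintegral_Ioi_le_of_hasDerivAt_sub
      (P := fun x => primitive f x ^ p * x ^ (-(p - 1))) (fun x hx => ?_) ?_ ?_
      (fun x hx => ?_) (fun x hx => ?_) (fun x hx => ?_) ?_
    · have hF := (h.hasDerivAt_primitive x).rpow_const (p := p)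
        (Or.inl (h.primitive_pos hx).ne')
      have hx' := Real.hasDerivAt_rpow_const (x := x) (p := -(p - 1)) (Or.inl (ne_of_gt hx))
      refine (hF.mul hx').congr_deriv ?_
      rw [show -(p - 1) - 1 = -(p - 1 + 1) by ring]
      ring
    · exact continuousOn_const.mul (h.continuous.continuousOn.mul ((hFc _).mul (hxc _)))
    · exact continuousOn_const.mul ((hFc _).mul (hxc _))
    · have h1 := h.pos x
      have h2 := h.primitive_pos hx
      have h3 : 0 < x := hx
      positivity
    · exact mul_nonneg hp1.le (h.massDensity_pos hx).le
    · exact (h.massDensity_pos hx).le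
    · refine squeeze_zero' (g := fun x => L ^ p * x) ?_ ?_ ?_
      · filter_upwards [self_mem_nhdsWithin] with x hx using (h.massDensity_pos hx).le
      · filter_upwards [self_mem_nhdsWithin] with x hx
        have hx0 : 0 < x := hx
        calc primitive f x ^ p * x ^ (-(p - 1)) ≤ (L * x) ^ p * x ^ (-(p - 1)) := by
              gcongr
              · exact (h.primitive_pos hx).le
              · exact h.primitive_le_mul hx0.le
          _ = L ^ p * x := by
              rw [Real.mul_rpow h.bound_pos.le hx0.le, mul_assoc, ← Real.rpow_add hx0,
                show p + -(p - 1) = 1 by ring, Real.rpow_one]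
      · have : Tendsto (fun x : ℝ => L ^ p * x) (𝓝 0) (𝓝 (L ^ p * 0)) := tendsto_id.const_mul _
        rw [mul_zero] at this
        exact this.mono_left nhdsWithin_le_nhds
  have hupp : ∫⁻ x in Ioi (0 : ℝ), ENNReal.ofReal
        (p * (f x * (primitive f x ^ (p - 1) * x ^ (-(p - 1))))) ≤
      ENNReal.ofReal p * ((∫⁻ x in Ioi (0 : ℝ), ENNReal.ofReal (f x ^ p)) ^ (1 / p) *
        ENNReal.ofReal J ^ (1 / (p / (p - 1)))) := by
    simp_rw [ENNReal.ofReal_mul hp0.le]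
    rw [lintegral_const_mul' _ _ ENNReal.ofReal_ne_top]
    gcongr
    refine (h.lintegral_mul_le hp (g := fun x => primitive f x ^ (p - 1) * x ^ (-(p - 1)))
      ((hFc _).mul (hxc _)) fun x hx => (h.massDensity_pos hx).le).trans (le_of_eq ?_)
    congr 2
    rw [← hJe]
    refine setLIntegral_congr_fun measurableSet_Ioi fun x hx => ?_
    have hx0 : 0 < x := hx
    have hF := h.primitive_pos hx
    rw [Real.mul_rpow (by positivity) (by positivity), ← Real.rpow_mul hF.le,
      ← Real.rpow_mul hx0.le]
    congr 3 <;> field_simp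
    ring
  have hmain := hL.ge.trans (hparts.trans hupp)
  rw [hL, ENNReal.ofReal_rpow_of_nonneg (by positivity) (by positivity)]
  set N := (∫⁻ x in Ioi (0 : ℝ), ENNReal.ofReal (f x ^ p)) ^ (1 / p) with hN
  clear_value N J
  have hk : 0 < (p - 1) ^ (1 / p) * (p / (p - 1)) := by positivity
  rcases eq_or_ne N ∞ with rfl | hNtop
  · rw [ENNReal.mul_top (by simpa using hk)]
    exact le_top
  · rw [← ENNReal.ofReal_toReal hNtop] at hmain ⊢
    have hJκ : 0 < J ^ (1 / (p / (p - 1))) := Real.rpow_pos_of_pos hJ _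
    rw [ENNReal.ofReal_rpow_of_nonneg hJ.le (by positivity),
      ← ENNReal.ofReal_mul ENNReal.toReal_nonneg,
      ← ENNReal.ofReal_mul hp0.le, ENNReal.ofReal_le_ofReal_iff (by positivity)] at hmain
    rw [← ENNReal.ofReal_mul hk.le]
    refine ENNReal.ofReal_le_ofReal ?_
    rw [Real.mul_rpow hp1.le hJ.le, mul_assoc]
    gcongr
    have hsplit : J ^ (1 / p) * J ^ (1 / (p / (p - 1))) = J := by
      rw [← Real.rpow_add hJ, show 1 / p + 1 / (p / (p - 1)) = 1 by field_simp; ring,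
        Real.rpow_one]
    -- J is finite and positive for regular densities, which allows its power to be cancelled.
    rw [div_mul_eq_mul_div, le_div_iff₀ hp1, ← mul_le_mul_iff_left₀ hJκ]
    calc J ^ (1 / p) * (p - 1) * J ^ (1 / (p / (p - 1)))
        = (p - 1) * (J ^ (1 / p) * J ^ (1 / (p / (p - 1)))) := by ring
      _ = (p - 1) * J := by rw [hsplit]
      _ ≤ _ := hmain
      _ = _ := by ring

end IsRegularDensity

/-! ### The sharp factor in the two regimes. -/

theorem sharpFactor_self {p : ℝ} (hp : 1 < p) :
    sharpFactor p p = (p - 1) ^ (1 / p) * (p / (p - 1)) := by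
  have hp0 : 0 < p := by linarith
  have hp1 : 0 < p - 1 := by linarith
  have h1 : 1 / (p / (p - 1)) = 1 - 1 / p := by field_simp
  rw [sharpFactor, if_pos rfl, Real.conjExponent, h1,
    Real.rpow_sub (by positivity), Real.rpow_one, Real.div_rpow hp0.le hp1.le]
  have h2 : 0 < p ^ (1 / p) := by positivity
  have h3 : 0 < (p - 1) ^ (1 / p) := by positivity
  field_simp

theorem sharpFactor_of_lt {p q : ℝ} (hp : 1 < p) (hpq : p < q) :
    sharpFactor q p = ((q / p - 1) / eulerBeta (1 / (q / p - 1))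
      (q / p.conjExponent / (q / p - 1) + 1)) ^ (1 / p - 1 / q) := by
  have hp0 : 0 < p := by linarith
  have hp1 : 0 < p - 1 := by linarith
  have hr : 0 < q / p - 1 := by
    rw [sub_pos, lt_div_iff₀ hp0]; linarith
  rw [sharpFactor, if_neg hpq.ne]
  congr 3
  rw [div_add_one hr.ne', Real.conjExponent]
  congr 1
  field_simp
  ring

theorem sharpFactor_pos {p q : ℝ} (hp : 1 < p) (hpq : p ≤ q) : 0 < sharpFactor q p := by
  have hp0 : 0 < p := by linarith
  have hp1 : 0 < p - 1 := by linarith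
  rcases hpq.eq_or_lt with rfl | hlt
  · rw [sharpFactor_self hp]
    positivity
  · have hr : 0 < q / p - 1 := by
      rw [sub_pos, lt_div_iff₀ hp0]; linarith
    have hq : 0 < q - 1 := by linarith
    rw [sharpFactor, if_neg hlt.ne]
    exact Real.rpow_pos_of_pos (div_pos hr (eulerBeta_pos (by positivity) (by positivity))) _

theorem lintegral_Ioc_eq_ofReal_primitive {f : ℝ → ℝ} {L K x : ℝ} (h : IsRegularDensity f L K)
    (hx : 0 ≤ x) :
    ∫⁻ y in Ioc 0 x, ENNReal.ofReal (f y) = ENNReal.ofReal (primitive f x) := by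
  rw [primitive, intervalIntegral.integral_of_le hx, ofReal_integral_eq_lintegral_ofReal]
  · exact (intervalIntegrable_iff_integrableOn_Ioc_of_le hx).1
      (h.continuous.intervalIntegrable _ _)
  · exact ae_of_all _ fun y => (h.pos y).le

theorem IsRegularDensity.bliss {f : ℝ → ℝ} {L K p q : ℝ} (h : IsRegularDensity f L K)
    (hp : 1 < p) (hpq : p ≤ q) :
    (∫⁻ x in Ioi (0 : ℝ), (∫⁻ y in Ioc 0 x, ENNReal.ofReal (f y)) ^ q *
        ENNReal.ofReal (q / p.conjExponent * x ^ (-(q / p.conjExponent + 1)))) ^ (1 / q) ≤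
      ENNReal.ofReal (sharpFactor q p) *
        (∫⁻ y in Ioi (0 : ℝ), ENNReal.ofReal (f y ^ p)) ^ (1 / p) := by
  have hp0 : 0 < p := by linarith
  have hp1 : 0 < p - 1 := by linarith
  have hq0 : 0 < q := by linarith
  have hα : 0 < q / p.conjExponent := by rw [Real.conjExponent]; positivity
  have hrw : ∫⁻ x in Ioi (0 : ℝ), (∫⁻ y in Ioc 0 x, ENNReal.ofReal (f y)) ^ q *
        ENNReal.ofReal (q / p.conjExponent * x ^ (-(q / p.conjExponent + 1))) =
      ∫⁻ x in Ioi (0 : ℝ), ENNReal.ofReal (q / p.conjExponent *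
        (primitive f x ^ q * x ^ (-(q / p.conjExponent + 1)))) := by
    refine setLIntegral_congr_fun measurableSet_Ioi fun x hx => ?_
    have hF := (h.primitive_pos hx).le
    rw [lintegral_Ioc_eq_ofReal_primitive h (le_of_lt hx), ENNReal.ofReal_rpow_of_nonneg hF hq0.le,
      ← ENNReal.ofReal_mul (by positivity)]
    congr 1
    ring
  rw [hrw]
  rcases hpq.eq_or_lt with rfl | hlt
  · have hα' : p / p.conjExponent = p - 1 := by rw [Real.conjExponent]; field_simp
    rw [hα', sharpFactor_self hp]
    exact h.hardy hp
  · have hr : 0 < q / p - 1 := by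
      rw [sub_pos, lt_div_iff₀ hp0]; linarith
    rw [sharpFactor_of_lt hp hlt]
    refine h.bliss_of_lt hp hr (by field_simp; ring) ?_
    rw [Real.conjExponent]
    field_simp
    ring

/-! ### Extension to measurable functions by approximation. -/

theorem memLp_gaussian {p : ℝ≥0∞} (hp0 : p ≠ 0) (hp : p ≠ ∞) :
    MemLp (fun x : ℝ => Real.exp (-x ^ 2)) p := by
  rw [← integrable_norm_rpow_iff (by fun_prop) hp0 hp]
  have := integrable_exp_neg_mul_sq (ENNReal.toReal_pos hp0 hp)
  refine this.congr (ae_of_all _ fun x => ?_)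
  simp only [Real.norm_of_nonneg (Real.exp_pos _).le]
  rw [← Real.exp_mul]
  congr 1
  ring

/-- The Gaussian supplies strict positivity without spoiling boundedness or integrability. -/
theorem isRegularDensity_abs_add_gaussian {g : ℝ → ℝ} (hg : Continuous g)
    (hgs : HasCompactSupport g) {ε : ℝ} (hε : 0 < ε) :
    ∃ L K, IsRegularDensity (fun x => |g x| + ε * Real.exp (-x ^ 2)) L K := by
  obtain ⟨C, hC⟩ := hg.bounded_above_of_compact_support hgs
  have hc : Continuous fun x => |g x| + ε * Real.exp (-x ^ 2) := by fun_prop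
  have hpos : ∀ x, 0 < |g x| + ε * Real.exp (-x ^ 2) := fun x => by positivity
  have hint : Integrable fun x => |g x| + ε * Real.exp (-x ^ 2) := by
    refine (hg.integrable_of_hasCompactSupport hgs).abs.add (Integrable.const_mul ?_ ε)
    exact memLp_one_iff_integrable.1 (memLp_gaussian one_ne_zero ENNReal.one_ne_top)
  refine ⟨C + ε, ∫ x, |g x| + ε * Real.exp (-x ^ 2), hc, hpos, fun x => ?_, fun x hx => ?_⟩
  · have h1 : Real.exp (-x ^ 2) ≤ 1 := Real.exp_le_one_iff.2 (by nlinarith [sq_nonneg x])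
    have h2 : |g x| ≤ C := hC x
    nlinarith
  · rw [intervalIntegral.integral_of_le hx]
    exact setIntegral_le_integral hint (ae_of_all _ fun x => (hpos x).le)

/-- Nonnegative functions of class `L^p` are limits in `L^p` of regular densities. -/
theorem exists_isRegularDensity_eLpNorm_sub_le {p : ℝ≥0∞} (hp1 : 1 ≤ p) (hp : p ≠ ∞)
    {f : ℝ → ℝ} (hf : MemLp f p) (hf0 : ∀ x, 0 ≤ f x) {δ : ℝ≥0∞} (hδ : δ ≠ 0) :
    ∃ h L K, IsRegularDensity h L K ∧ eLpNorm (f - h) p volume ≤ δ := by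
  have hδ2 : δ / 2 ≠ 0 := by simpa using hδ
  obtain ⟨g, hgs, hge, hgc, hgm⟩ := hf.exists_hasCompactSupport_eLpNorm_sub_le hp hδ2
  have hG := memLp_gaussian (p := p) (by positivity) hp
  obtain ⟨ε, hε, hεle⟩ : ∃ ε : ℝ, 0 < ε ∧
      ENNReal.ofReal ε * eLpNorm (fun x : ℝ => Real.exp (-x ^ 2)) p volume ≤ δ / 2 := by
    have ht : Tendsto (fun ε : ℝ => ENNReal.ofReal ε *
        eLpNorm (fun x : ℝ => Real.exp (-x ^ 2)) p volume) (𝓝[>] 0) (𝓝 0) := by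
      have := ENNReal.Tendsto.mul_const (ENNReal.tendsto_ofReal (tendsto_id (α := ℝ) (x := 𝓝 0)))
        (Or.inr hG.eLpNorm_ne_top)
      simp only [ENNReal.ofReal_zero, zero_mul, id] at this
      exact this.mono_left nhdsWithin_le_nhds
    have hev := ht.eventually (Iic_mem_nhds (pos_iff_ne_zero.2 hδ2))
    obtain ⟨ε, h1, h2⟩ := (hev.and self_mem_nhdsWithin).exists
    exact ⟨ε, h2, h1⟩
  obtain ⟨L, K, hreg⟩ := isRegularDensity_abs_add_gaussian hgc hgs hε
  refine ⟨_, L, K, hreg, ?_⟩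
  have hεm : AEStronglyMeasurable (fun x : ℝ => ε * Real.exp (-x ^ 2)) :=
    (by fun_prop : Continuous fun x : ℝ => ε * Real.exp (-x ^ 2)).aestronglyMeasurable
  have e1 : (f - fun x => |g x| + ε * Real.exp (-x ^ 2)) =
      (fun x => f x - |g x|) - fun x => ε * Real.exp (-x ^ 2) := by
    ext x
    simp only [Pi.sub_apply]
    ring
  rw [e1]
  refine (eLpNorm_sub_le (hf.1.sub hgm.1.norm) hεm hp1).trans ?_
  rw [← ENNReal.add_halves δ]
  refine add_le_add (le_trans (eLpNorm_mono fun x => ?_) hge) (le_trans (le_of_eq ?_) hεle)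
  · rw [Pi.sub_apply, Real.norm_eq_abs, Real.norm_eq_abs]
    have := abs_abs_sub_abs_le_abs_sub (f x) (g x)
    rwa [abs_of_nonneg (hf0 x)] at this
  · have := eLpNorm_const_smul ε (fun x : ℝ => Real.exp (-x ^ 2)) p volume
    rw [← Real.enorm_of_nonneg hε.le, ← this]
    rfl

theorem ofReal_lintegral_rpow_eq_eLpNorm {p : ℝ} (hp : 0 < p) {f : ℝ → ℝ} (hf0 : ∀ x, 0 ≤ f x)
    (μ : Measure ℝ) :
    (∫⁻ y, ENNReal.ofReal (f y ^ p) ∂μ) ^ (1 / p) = eLpNorm f (ENNReal.ofReal p) μ := by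
  rw [eLpNorm_eq_lintegral_rpow_enorm_toReal (by simpa using hp) ENNReal.ofReal_ne_top,
    ENNReal.toReal_ofReal hp.le]
  congr 1
  refine lintegral_congr fun y => ?_
  rw [Real.enorm_of_nonneg (hf0 y), ENNReal.ofReal_rpow_of_nonneg (hf0 y) hp.le]

theorem setLIntegral_le_add_eLpNorm_sub {p : ℝ} (hp : 1 < p) {f g : ℝ → ℝ} (hf : Measurable f)
    (hg : Measurable g) (x : ℝ) :
    ∫⁻ y in Ioc 0 x, ENNReal.ofReal (f y) ≤ (∫⁻ y in Ioc 0 x, ENNReal.ofReal (g y)) +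
      eLpNorm (f - g) (ENNReal.ofReal p) volume * ENNReal.ofReal x ^ (1 - 1 / p) := by
  have hH := eLpNorm_le_eLpNorm_mul_rpow_measure_univ (μ := volume.restrict (Ioc 0 x))
    (p := 1) (q := ENNReal.ofReal p) (by simpa using hp.le) (f := f - g)
    (hf.sub hg).aestronglyMeasurable
  rw [ENNReal.toReal_ofReal (by linarith), ENNReal.toReal_one, Measure.restrict_apply_univ,
    Real.volume_Ioc, sub_zero, div_one, eLpNorm_one_eq_lintegral_enorm] at hH
  calc ∫⁻ y in Ioc 0 x, ENNReal.ofReal (f y)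
      ≤ ∫⁻ y in Ioc 0 x, (ENNReal.ofReal (g y) + ‖(f - g) y‖ₑ) := by
        refine lintegral_mono fun y => ?_
        rw [← ofReal_norm]
        refine le_trans (ENNReal.ofReal_le_ofReal ?_) ENNReal.ofReal_add_le
        rw [Pi.sub_apply, Real.norm_eq_abs]
        linarith [le_abs_self (f y - g y)]
    _ = (∫⁻ y in Ioc 0 x, ENNReal.ofReal (g y)) + ∫⁻ y in Ioc 0 x, ‖(f - g) y‖ₑ :=
        lintegral_add_left hg.ennreal_ofReal _
    _ ≤ _ := by
        gcongr
        refine hH.trans ?_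
        gcongr
        exact Measure.restrict_le_self

/-- Bliss's inequality on the half-line, with the sharp constant; for `p = q` it is Hardy's
inequality. -/
theorem bliss_halfLine {p q : ℝ} (hp : 1 < p) (hpq : p ≤ q) {f : ℝ → ℝ} (hf : Measurable f)
    (hf0 : ∀ x, 0 ≤ f x) :
    (∫⁻ x in Ioi (0 : ℝ), (∫⁻ y in Ioc 0 x, ENNReal.ofReal (f y)) ^ q *
        ENNReal.ofReal (q / p.conjExponent * x ^ (-(q / p.conjExponent + 1)))) ^ (1 / q) ≤
      ENNReal.ofReal (sharpFactor q p) *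
        (∫⁻ y in Ioi (0 : ℝ), ENNReal.ofReal (f y ^ p)) ^ (1 / p) := by
  have hp0 : 0 < p := by linarith
  have hq0 : 0 < q := by linarith
  have hk := sharpFactor_pos hp hpq
  rw [ofReal_lintegral_rpow_eq_eLpNorm hp0 hf0]
  rcases eq_or_ne (eLpNorm f (ENNReal.ofReal p) (volume.restrict (Ioi 0))) ∞ with htop | htop
  · rw [htop, ENNReal.mul_top (by simpa using hk)]
    exact le_top
  set u : ℝ → ℝ := indicator (Ioi 0) f with hu
  have hum : Measurable u := hf.indicator measurableSet_Ioi
  have hu0 : ∀ x, 0 ≤ u x := fun x => indicator_nonneg (fun y _ => hf0 y) x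
  have hue : eLpNorm u (ENNReal.ofReal p) volume =
      eLpNorm f (ENNReal.ofReal p) (volume.restrict (Ioi 0)) :=
    eLpNorm_indicator_eq_eLpNorm_restrict measurableSet_Ioi
  have huL : MemLp u (ENNReal.ofReal p) := ⟨hum.aestronglyMeasurable, by
    rw [hue]; exact htop.lt_top⟩
  have hfu : ∀ x, ∫⁻ y in Ioc 0 x, ENNReal.ofReal (f y) =
      ∫⁻ y in Ioc 0 x, ENNReal.ofReal (u y) := fun x =>
    setLIntegral_congr_fun measurableSet_Ioc fun y hy => by
      rw [hu, indicator_of_mem (show y ∈ Ioi (0 : ℝ) from hy.1)]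
  simp_rw [hfu]
  rw [← hue]
  have hp1 : (1 : ℝ≥0∞) ≤ ENNReal.ofReal p := by simpa using hp.le
  have hex : ∀ n : ℕ, ∃ h L K, IsRegularDensity h L K ∧
      eLpNorm (u - h) (ENNReal.ofReal p) volume ≤ ((n : ℝ≥0∞) + 1)⁻¹ := fun n =>
    exists_isRegularDensity_eLpNorm_sub_le hp1 ENNReal.ofReal_ne_top huL hu0 (by simp)
  choose h L K hreg hle using hex
  have hδ : Tendsto (fun n : ℕ => ((n : ℝ≥0∞) + 1)⁻¹) atTop (𝓝 0) := by
    have := (tendsto_add_atTop_iff_nat 1).2 ENNReal.tendsto_inv_nat_nhds_zero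
    simpa using this
  set U : ℝ → ℝ≥0∞ := fun x => ∫⁻ y in Ioc 0 x, ENNReal.ofReal (u y) with hU
  have hUm : Measurable U :=
    Monotone.measurable fun x y hxy => lintegral_mono_set (Ioc_subset_Ioc_right hxy)
  set w : ℝ → ℝ≥0∞ := fun x =>
    ENNReal.ofReal (q / p.conjExponent * x ^ (-(q / p.conjExponent + 1))) with hw
  have hwm : Measurable w := by fun_prop
  set d : ℕ → ℝ → ℝ≥0∞ := fun n x => ((n : ℝ≥0∞) + 1)⁻¹ * ENNReal.ofReal x ^ (1 - 1 / p) with hd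
  have hdm : ∀ n, Measurable (d n) := fun n => by fun_prop
  -- By Hölder on (0,x] the approximation error of the primitive is at most `d n x`. Truncated
  -- subtraction turns this into minorants that converge to U pointwise, so Fatou's lemma applies
  -- with no dominating function.
  have hsub : ∀ n x, U x - d n x ≤ ∫⁻ y in Ioc 0 x, ENNReal.ofReal (h n y) := by
    intro n x
    rw [tsub_le_iff_right]
    refine (setLIntegral_le_add_eLpNorm_sub hp hum (hreg n).continuous.measurable x).trans ?_
    simp only [hd]
    gcongr
    exact hle n
  have hbound : ∀ n, ∫⁻ x in Ioi (0 : ℝ), (U x - d n x) ^ q * w x ≤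
      (ENNReal.ofReal (sharpFactor q p) *
        (eLpNorm u (ENNReal.ofReal p) volume + ((n : ℝ≥0∞) + 1)⁻¹)) ^ q := by
    intro n
    have hb := (hreg n).bliss hp hpq
    rw [ofReal_lintegral_rpow_eq_eLpNorm hp0 fun x => ((hreg n).pos x).le] at hb
    have hnorm : eLpNorm (h n) (ENNReal.ofReal p) (volume.restrict (Ioi 0)) ≤
        eLpNorm u (ENNReal.ofReal p) volume + ((n : ℝ≥0∞) + 1)⁻¹ := by
      refine (eLpNorm_mono_measure _ Measure.restrict_le_self).trans ?_
      have e : h n = u - (u - h n) := by simp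
      rw [e]
      refine (eLpNorm_sub_le hum.aestronglyMeasurable
        (hum.sub (hreg n).continuous.measurable).aestronglyMeasurable hp1).trans ?_
      gcongr
      exact hle n
    have hb' := hb.trans (mul_le_mul_right hnorm _)
    rw [one_div, ENNReal.rpow_inv_le_iff hq0] at hb'
    refine le_trans (lintegral_mono fun x => ?_) hb'
    gcongr
    exact hsub n x
  rw [one_div, ENNReal.rpow_inv_le_iff hq0]
  have hlim : Tendsto (fun n : ℕ => (ENNReal.ofReal (sharpFactor q p) *
      (eLpNorm u (ENNReal.ofReal p) volume + ((n : ℝ≥0∞) + 1)⁻¹)) ^ q) atTop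
      (𝓝 ((ENNReal.ofReal (sharpFactor q p) * eLpNorm u (ENNReal.ofReal p) volume) ^ q)) := by
    have h1 := hδ.const_add (eLpNorm u (ENNReal.ofReal p) volume)
    rw [add_zero] at h1
    exact (ENNReal.Tendsto.const_mul h1 (Or.inr ENNReal.ofReal_ne_top)).ennrpow_const q
  have hpt : ∀ x, Tendsto (fun n => (U x - d n x) ^ q * w x) atTop (𝓝 (U x ^ q * w x)) := by
    intro x
    have h1 : Tendsto (fun n => d n x) atTop (𝓝 0) := by
      have := ENNReal.Tendsto.mul_const (b := ENNReal.ofReal x ^ (1 - 1 / p)) hδ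
        (Or.inr (ENNReal.rpow_ne_top_of_nonneg (by
          rw [sub_nonneg, div_le_one hp0]; exact hp.le) ENNReal.ofReal_ne_top))
      simpa [hd] using this
    have h2 := ENNReal.Tendsto.sub (tendsto_const_nhds (x := U x) (f := atTop)) h1
      (Or.inr ENNReal.zero_ne_top)
    rw [tsub_zero] at h2
    exact ENNReal.Tendsto.mul_const (h2.ennrpow_const q) (Or.inr ENNReal.ofReal_ne_top)
  calc ∫⁻ x in Ioi (0 : ℝ), U x ^ q * w x
      = ∫⁻ x in Ioi (0 : ℝ), liminf (fun n => (U x - d n x) ^ q * w x) atTop :=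
        lintegral_congr fun x => (hpt x).liminf_eq.symm
    _ ≤ liminf (fun n => ∫⁻ x in Ioi (0 : ℝ), (U x - d n x) ^ q * w x) atTop :=
        lintegral_liminf_le fun n => ((hUm.sub (hdm n)).pow_const q).mul hwm
    _ ≤ liminf (fun n : ℕ => (ENNReal.ofReal (sharpFactor q p) *
          (eLpNorm u (ENNReal.ofReal p) volume + ((n : ℝ≥0∞) + 1)⁻¹)) ^ q) atTop :=
        liminf_le_liminf (Eventually.of_forall hbound)
    _ = _ := hlim.liminf_eq

/-! ### The quantile function and the power-tail measure. -/

theorem cumul_mono (ν : Measure ℝ) : Monotone (cumul ν) :=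
  fun _ _ h => measure_mono (Iic_subset_Iic.2 h)

theorem Ioi_eq_iUnion_Ioi_add (x : ℝ) : Ioi x = ⋃ n : ℕ, Ioi (x + 1 / ((n : ℝ) + 1)) := by
  ext y
  simp only [mem_Ioi, mem_iUnion]
  constructor
  · intro hy
    obtain ⟨n, hn⟩ := exists_nat_one_div_lt (sub_pos.2 hy)
    exact ⟨n, by linarith⟩
  · rintro ⟨n, hn⟩
    have : (0 : ℝ) < 1 / ((n : ℝ) + 1) := by positivity
    linarith

/-- If `S` is finite somewhere and never jumps to `∞` immediately to the right of a point where it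
is finite, it has a quantile function, the left-continuous generalized inverse. -/
theorem exists_quantile {ν : Measure ℝ} (hS : Tendsto (cumul ν) atTop (𝓝 ∞))
    (hfin : ∃ x, cumul ν x < ∞) (hright : ∀ x, cumul ν x < ∞ → ∃ y > x, cumul ν y < ∞) :
    ∃ T : ℝ → ℝ, Measurable T ∧ ∀ s > 0, ∀ x, T s ≤ x ↔ ENNReal.ofReal s ≤ cumul ν x := by
  have hbot : Tendsto (cumul ν) atBot (𝓝 0) := by
    obtain ⟨x₀, hx₀⟩ := hfin
    have h := tendsto_measure_iInter_atBot (μ := ν) (s := fun x : ℝ => Iic x)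
      (fun x => measurableSet_Iic.nullMeasurableSet) (fun _ _ h => Iic_subset_Iic.2 h)
      ⟨x₀, hx₀.ne⟩
    have he : ⋂ x : ℝ, Iic x = ∅ := by
      refine eq_empty_of_forall_notMem fun y hy => ?_
      have : y ≤ y - 1 := mem_iInter.1 hy (y - 1)
      linarith
    rw [he, measure_empty] at h
    exact h
  have hne : ∀ s : ℝ, {x | ENNReal.ofReal s ≤ cumul ν x}.Nonempty := fun s =>
    (hS.eventually (Ici_mem_nhds ENNReal.ofReal_lt_top)).exists
  have hbdd : ∀ s > 0, BddBelow {x | ENNReal.ofReal s ≤ cumul ν x} := by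
    intro s hs
    obtain ⟨b, hb⟩ := (hbot.eventually (Iio_mem_nhds (ENNReal.ofReal_pos.2 hs))).exists
    exact ⟨b, fun x hx => le_of_not_gt fun hlt =>
      absurd ((cumul_mono ν hlt.le).trans_lt hb) (not_lt.2 hx)⟩
  have hmem : ∀ s > 0, ENNReal.ofReal s ≤ cumul ν (sInf {x | ENNReal.ofReal s ≤ cumul ν x}) := by
    intro s hs
    set t := sInf {x | ENNReal.ofReal s ≤ cumul ν x} with ht
    rcases eq_or_ne (cumul ν t) ∞ with htop | htop
    · rw [htop]; exact le_top
    -- Continuity of ν from above at t needs a set of finite measure to start from, which is what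
    -- `hright` provides.
    obtain ⟨y, hy, hyf⟩ := hright t htop.lt_top
    have h := tendsto_measure_biInter_gt (μ := ν) (s := fun x : ℝ => Iic x) (a := t)
      (fun x _ => measurableSet_Iic.nullMeasurableSet) (fun _ _ _ h => Iic_subset_Iic.2 h)
      ⟨y, hy, hyf.ne⟩
    have he : ⋂ x > t, Iic x = Iic t := by
      ext z
      simp only [mem_iInter, mem_Iic]
      exact ⟨fun h => le_of_forall_gt_imp_ge_of_dense h, fun h x hx => h.trans (le_of_lt hx)⟩
    rw [he] at h
    refine ge_of_tendsto h ?_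
    filter_upwards [self_mem_nhdsWithin] with x hx
    obtain ⟨z, hz, hzx⟩ := exists_lt_of_csInf_lt (hne s) hx
    exact le_trans hz (cumul_mono ν hzx.le)
  have hgal : ∀ s > 0, ∀ x, sInf {x | ENNReal.ofReal s ≤ cumul ν x} ≤ x ↔
      ENNReal.ofReal s ≤ cumul ν x := fun s hs x =>
    ⟨fun h => (hmem s hs).trans (cumul_mono ν h), fun h => csInf_le (hbdd s hs) h⟩
  -- For s ≤ 0 the set is all of ℝ and has no infimum; the value 0 there keeps the preimages
  -- explicit.
  refine ⟨indicator (Ioi 0) fun s => sInf {x | ENNReal.ofReal s ≤ cumul ν x}, ?_, ?_⟩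
  · refine measurable_of_Iic fun x => ?_
    have he : indicator (Ioi 0) (fun s => sInf {x | ENNReal.ofReal s ≤ cumul ν x}) ⁻¹' Iic x =
        (Ioi 0 ∩ {s | ENNReal.ofReal s ≤ cumul ν x}) ∪ (Iic 0 ∩ {_s | 0 ≤ x}) := by
      ext s
      rcases lt_or_ge 0 s with hs | hs
      · simp [hs, hgal s hs x]
      · simp [hs, not_lt.2 hs]
    rw [he]
    exact (measurableSet_Ioi.inter (measurableSet_le ENNReal.measurable_ofReal
      measurable_const)).union (measurableSet_Iic.inter (MeasurableSet.const _))
  · intro s hs x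
    rw [indicator_of_mem (mem_Ioi.2 hs)]
    exact hgal s hs x

noncomputable section

/-- The measure on `(0, ∞)` with tail `μ((a, ∞)) = a ^ (-α)`. -/
def powerTail (α : ℝ) : Measure ℝ :=
  (volume.restrict (Ioi 0)).withDensity fun t => ENNReal.ofReal (α * t ^ (-(α + 1)))

end

theorem lintegral_Ioi_powerTail {α a : ℝ} (hα : 0 < α) (ha : 0 < a) :
    ∫⁻ t in Ioi a, ENNReal.ofReal (α * t ^ (-(α + 1))) = ENNReal.ofReal (a ^ (-α)) := by
  have hlt : -(α + 1) < -1 := by linarith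
  have hint : IntegrableOn (fun t : ℝ => α * t ^ (-(α + 1))) (Ioi a) :=
    (integrableOn_Ioi_rpow_of_lt hlt ha).const_mul α
  rw [← ofReal_integral_eq_lintegral_ofReal hint, integral_const_mul,
    integral_Ioi_rpow_of_lt hlt ha]
  · congr 1
    rw [show -(α + 1) + 1 = -α by ring]
    field_simp
  · filter_upwards [ae_restrict_mem measurableSet_Ioi] with t ht
    have : 0 < t := ha.trans ht
    simp only [Pi.zero_apply]
    positivity

theorem powerTail_lt {α : ℝ} (hα : 0 < α) (S : ℝ≥0∞) :
    powerTail α ({s | S < ENNReal.ofReal s} ∩ Ioi 0) = S ^ (-α) := by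
  have hpos : ∀ a : ℝ, 0 < a → powerTail α (Ioi a) = ENNReal.ofReal a ^ (-α) := by
    intro a ha
    rw [powerTail, withDensity_apply _ measurableSet_Ioi, Measure.restrict_restrict
      measurableSet_Ioi, Ioi_inter_Ioi, max_eq_left ha.le, lintegral_Ioi_powerTail hα ha,
      ENNReal.ofReal_rpow_of_pos ha]
  induction S with
  | top =>
    rw [ENNReal.top_rpow_of_neg (by linarith)]
    simp
  | coe S =>
    have he : {s | (S : ℝ≥0∞) < ENNReal.ofReal s} ∩ Ioi 0 = Ioi (S : ℝ) := by
      ext s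
      simp only [mem_inter_iff, mem_ofPred_eq, mem_Ioi]
      rw [← ENNReal.ofReal_coe_nnreal, ENNReal.ofReal_lt_ofReal_iff']
      exact ⟨fun h => h.1.1, fun h => ⟨⟨h, S.2.trans_lt h⟩, S.2.trans_lt h⟩⟩
    rw [he]
    rcases eq_or_lt_of_le S.2 with h0 | h0
    · have hS : S = 0 := NNReal.coe_eq_zero.1 h0.symm
      subst hS
      rw [ENNReal.coe_zero, ENNReal.zero_rpow_of_neg (by linarith), NNReal.coe_zero]
      -- The density is not integrable at 0: the tails beyond a > 0 are unbounded as a decreases,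
      -- matching the convention for S = 0.
      have ht : Tendsto (fun a : ℝ => ENNReal.ofReal a ^ (-α)) (𝓝[>] 0) (𝓝 ∞) := by
        have := ((ENNReal.continuous_rpow_const (y := -α)).tendsto 0).comp
          (ENNReal.ofReal_zero ▸ ENNReal.tendsto_ofReal (tendsto_id (α := ℝ) (x := 𝓝 0)))
        rw [ENNReal.zero_rpow_of_neg (by linarith)] at this
        exact this.mono_left nhdsWithin_le_nhds
      refine top_le_iff.1 (le_of_tendsto ht ?_)
      filter_upwards [self_mem_nhdsWithin] with a ha
      rw [← hpos a ha]
      exact measure_mono (Ioi_subset_Ioi (le_of_lt ha))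
    · rw [show Ioi (S : ℝ) = Ioi S.1 from rfl, hpos S.1 h0]
      congr 1
      exact ENNReal.ofReal_coe_nnreal

section quantile

variable {ν : Measure ℝ} {T : ℝ → ℝ}

theorem map_quantile_Iic (hTm : Measurable T)
    (hT : ∀ s > 0, ∀ x, T s ≤ x ↔ ENNReal.ofReal s ≤ cumul ν x) (x : ℝ) :
    (volume.restrict (Ioi 0)).map T (Iic x) = cumul ν x := by
  rw [Measure.map_apply hTm measurableSet_Iic, Measure.restrict_apply (hTm measurableSet_Iic)]
  have he : T ⁻¹' Iic x ∩ Ioi 0 = {s | ENNReal.ofReal s ≤ cumul ν x} ∩ Ioi 0 := by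
    ext s
    simp only [mem_inter_iff, mem_preimage, mem_Iic, mem_ofPred_eq, mem_Ioi]
    exact and_congr_left fun hs => hT s hs x
  rw [he]
  generalize cumul ν x = S
  induction S with
  | top => simp
  | coe S =>
    have : {s | ENNReal.ofReal s ≤ (S : ℝ≥0∞)} ∩ Ioi 0 = Ioc 0 (S : ℝ) := by
      ext s
      simp only [mem_inter_iff, mem_ofPred_eq, mem_Ioi, mem_Ioc]
      rw [← ENNReal.ofReal_coe_nnreal, ENNReal.ofReal_le_ofReal_iff S.coe_nonneg]
      exact and_comm
    rw [this, Real.volume_Ioc, sub_zero, ENNReal.ofReal_coe_nnreal]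

theorem map_quantile_powerTail_Ioi {α : ℝ} (hα : 0 < α) (hTm : Measurable T)
    (hT : ∀ s > 0, ∀ x, T s ≤ x ↔ ENNReal.ofReal s ≤ cumul ν x) (x : ℝ) :
    (powerTail α).map T (Ioi x) = cumul ν x ^ (-α) := by
  rw [Measure.map_apply hTm measurableSet_Ioi, ← powerTail_lt hα (cumul ν x)]
  have h0 : powerTail α (Iic 0) = 0 := by
    rw [powerTail, withDensity_apply _ measurableSet_Iic, Measure.restrict_restrict
      measurableSet_Iic, Iic_inter_Ioi, Ioc_self, Measure.restrict_empty, lintegral_zero_measure]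
  have he : T ⁻¹' Ioi x ∩ Ioi 0 = {s | cumul ν x < ENNReal.ofReal s} ∩ Ioi 0 := by
    ext s
    simp only [mem_inter_iff, mem_preimage, mem_ofPred_eq, mem_Ioi]
    exact and_congr_left fun hs => by rw [← not_le, hT s hs x, not_le]
  have hsub : T ⁻¹' Ioi x \ Ioi 0 ⊆ Iic 0 := by
    rw [sdiff_eq, compl_Ioi]
    exact inter_subset_right
  have hdiff : powerTail α (T ⁻¹' Ioi x \ Ioi 0) = 0 := measure_mono_null hsub h0
  rw [← he, ← measure_inter_add_sdiff (T ⁻¹' Ioi x) (measurableSet_Ioi (a := (0 : ℝ))), hdiff,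
    add_zero]

end quantile

/-! ### Comparison of the two measures with images under the quantile function. -/

theorem MeasureTheory.Measure.restrict_Iic_eq_of_forall {μ ν : Measure ℝ} {a : ℝ}
    (hfin : μ (Iic a) < ∞) (h : ∀ x, μ (Iic x) = ν (Iic x)) :
    μ.restrict (Iic a) = ν.restrict (Iic a) := by
  have : IsFiniteMeasure (μ.restrict (Iic a)) := ⟨by rwa [Measure.restrict_apply_univ]⟩
  refine Measure.ext_of_Iic _ _ fun x => ?_
  rw [Measure.restrict_apply measurableSet_Iic, Measure.restrict_apply measurableSet_Iic,
    Iic_inter_Iic, h]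

theorem MeasureTheory.Measure.restrict_Ioi_eq_of_forall {μ ν : Measure ℝ} {a : ℝ}
    (hfin : μ (Ioi a) < ∞) (h : ∀ x, μ (Ioi x) = ν (Ioi x)) :
    μ.restrict (Ioi a) = ν.restrict (Ioi a) := by
  have h1 : IsFiniteMeasure (μ.restrict (Ioi a)) := ⟨by rwa [Measure.restrict_apply_univ]⟩
  have h2 : IsFiniteMeasure (ν.restrict (Ioi a)) :=
    ⟨by rw [Measure.restrict_apply_univ, ← h]; exact hfin⟩
  refine Measure.ext_of_Iic _ _ fun x => ?_
  rw [← compl_Ioi, measure_compl measurableSet_Ioi (measure_ne_top _ _),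
    measure_compl measurableSet_Ioi (measure_ne_top _ _), Measure.restrict_apply_univ,
    Measure.restrict_apply_univ, Measure.restrict_apply measurableSet_Ioi,
    Measure.restrict_apply measurableSet_Ioi, Ioi_inter_Ioi, h, h]

/-- If S were infinite immediately to the right of x, continuity from below would make the tail of
ν' at x vanish, whereas a finite S(x) makes it positive. -/
theorem cumul_finite_right_of_tail {ν ν' : Measure ℝ} {α : ℝ} (hα : 0 < α)
    (hν' : ∀ x, ν' (Ioi x) = cumul ν x ^ (-α)) {x : ℝ} (hx : cumul ν x < ∞) :
    ∃ y > x, cumul ν y < ∞ := by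
  by_contra! hall
  have h0 : ν' (Ioi x) = 0 := by
    rw [Ioi_eq_iUnion_Ioi_add]
    refine measure_iUnion_null fun n => ?_
    have hpos : (0 : ℝ) < 1 / ((n : ℝ) + 1) := by positivity
    rw [hν', top_le_iff.1 (hall _ (by linarith)), ENNReal.top_rpow_of_neg (by linarith)]
  rw [hν', ENNReal.rpow_eq_zero_iff] at h0
  rcases h0 with h0 | h0
  · linarith [h0.2]
  · exact hx.ne h0.1

theorem measure_eq_zero_of_tail {ν ν' : Measure ℝ} {α : ℝ} (hα : 0 < α)
    (hν' : ∀ x, ν' (Ioi x) = cumul ν x ^ (-α)) (htop : ∀ x, cumul ν x = ∞) : ν' = 0 := by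
  rw [← Measure.measure_univ_eq_zero]
  have hU : (univ : Set ℝ) = ⋃ n : ℕ, Ioi (-(n : ℝ)) := by
    refine (eq_univ_of_forall fun x => mem_iUnion.2 ?_).symm
    obtain ⟨n, hn⟩ := exists_nat_gt (-x)
    exact ⟨n, by rw [mem_Ioi]; linarith⟩
  rw [hU]
  refine measure_iUnion_null fun n => ?_
  rw [hν', htop, ENNReal.top_rpow_of_neg (by linarith)]

section quantile

variable {ν ν' : Measure ℝ} {T : ℝ → ℝ} {α : ℝ}

theorem lt_of_quantile_lt (hT : ∀ s > 0, ∀ x, T s ≤ x ↔ ENNReal.ofReal s ≤ cumul ν x)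
    {s t : ℝ} (hs : 0 < s) (ht : 0 < t) (h : T s < T t) : s < t := by
  by_contra! hle
  refine absurd h (not_lt.2 ((hT t ht _).2 ?_))
  exact (ENNReal.ofReal_le_ofReal hle).trans ((hT s hs _).1 le_rfl)

theorem cumul_lt_top_of_lt_quantile
    (hT : ∀ s > 0, ∀ x, T s ≤ x ↔ ENNReal.ofReal s ≤ cumul ν x) {t y : ℝ} (ht : 0 < t)
    (h : y < T t) : cumul ν y < ∞ := by
  have := (not_congr (hT t ht y)).1 (not_le.2 h)
  exact (not_le.1 this).trans ENNReal.ofReal_lt_top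

theorem measurableSet_cumul_lt_top (ν : Measure ℝ) : MeasurableSet {y | cumul ν y < ∞} :=
  measurableSet_lt (cumul_mono ν).measurable measurable_const

/-- Distribution functions determine measures only where finite. By `hright`, countably many
half-lines of finite mass cover the region, and equality on each of them glues. -/
theorem restrict_cumul_lt_top_eq (hTm : Measurable T)
    (hT : ∀ s > 0, ∀ x, T s ≤ x ↔ ENNReal.ofReal s ≤ cumul ν x)
    (hright : ∀ x, cumul ν x < ∞ → ∃ y > x, cumul ν y < ∞) :
    ν.restrict {y | cumul ν y < ∞} =
      ((volume.restrict (Ioi 0)).map T).restrict {y | cumul ν y < ∞} := by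
  have hV : {y | cumul ν y < ∞} = ⋃ r : {r : ℚ // cumul ν r < ∞}, Iic (r.1 : ℝ) := by
    ext y
    simp only [mem_ofPred_eq, mem_iUnion, mem_Iic]
    constructor
    · intro hy
      obtain ⟨z, hz, hzf⟩ := hright y hy
      obtain ⟨r, hr1, hr2⟩ := exists_rat_btwn hz
      exact ⟨⟨r, (cumul_mono ν hr2.le).trans_lt hzf⟩, hr1.le⟩
    · rintro ⟨r, hr⟩
      exact (cumul_mono ν hr).trans_lt r.2
  rw [hV, Measure.restrict_iUnion_congr]
  exact fun r => Measure.restrict_Iic_eq_of_forall r.2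
    fun x => (map_quantile_Iic hTm hT x).symm

/-- A positive value S(y) makes the tail at y finite, so tails determine the measure on each
half-line beyond such a rational point. -/
theorem restrict_exists_cumul_pos_eq (hα : 0 < α) (hTm : Measurable T)
    (hT : ∀ s > 0, ∀ x, T s ≤ x ↔ ENNReal.ofReal s ≤ cumul ν x)
    (hν' : ∀ x, ν' (Ioi x) = cumul ν x ^ (-α)) :
    ν'.restrict {x | ∃ y < x, 0 < cumul ν y} =
      ((powerTail α).map T).restrict {x | ∃ y < x, 0 < cumul ν y} := by
  have hU : {x | ∃ y < x, 0 < cumul ν y} =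
      ⋃ r : {r : ℚ // 0 < cumul ν r}, Ioi (r.1 : ℝ) := by
    ext x
    simp only [mem_ofPred_eq, mem_iUnion, mem_Ioi]
    constructor
    · rintro ⟨y, hy, hyp⟩
      obtain ⟨r, hr1, hr2⟩ := exists_rat_btwn hy
      exact ⟨⟨r, hyp.trans_le (cumul_mono ν hr1.le)⟩, hr2⟩
    · rintro ⟨r, hr⟩
      exact ⟨r.1, hr, r.2⟩
  rw [hU, Measure.restrict_iUnion_congr]
  refine fun r => Measure.restrict_Ioi_eq_of_forall ?_ fun x => ?_
  · rw [hν', lt_top_iff_ne_top, Ne, ENNReal.rpow_eq_top_iff]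
    rintro (h | h)
    · exact r.2.ne' h.1
    · linarith [h.2]
  · rw [hν', map_quantile_powerTail_Ioi hα hTm hT]

theorem measure_Iio_eq_zero_of_cumul {x : ℝ} (h : ∀ y < x, cumul ν y = 0) : ν (Iio x) = 0 := by
  have hU : Iio x ⊆ ⋃ r : {r : ℚ // (r : ℝ) < x}, Iic (r.1 : ℝ) := by
    intro y hy
    obtain ⟨r, hr1, hr2⟩ := exists_rat_btwn (mem_Iio.1 hy)
    exact mem_iUnion.2 ⟨⟨r, hr2⟩, hr1.le⟩
  exact measure_mono_null hU (measure_iUnion_null fun r => h _ r.2)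

/-- The half-line must be open: with an atom of ν at T(t), parameters beyond t may have the same
quantile. Strictly to the left of T(t), S is finite, so cutting f off changes nothing. -/
theorem setLIntegral_Iio_quantile_le (hTm : Measurable T)
    (hT : ∀ s > 0, ∀ x, T s ≤ x ↔ ENNReal.ofReal s ≤ cumul ν x)
    (hright : ∀ x, cumul ν x < ∞ → ∃ y > x, cumul ν y < ∞) {f : ℝ → ℝ} (hf : Measurable f)
    {t : ℝ} (ht : 0 < t) :
    ∫⁻ y in Iio (T t), ENNReal.ofReal (f y) ∂ν ≤
      ∫⁻ s in Ioc 0 t, ENNReal.ofReal (indicator {y | cumul ν y < ∞} f (T s)) := by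
  have hsub : Iio (T t) ⊆ {y | cumul ν y < ∞} := fun y hy => cumul_lt_top_of_lt_quantile hT ht hy
  have hres : ν.restrict (Iio (T t)) =
      ((volume.restrict (Ioi 0)).map T).restrict (Iio (T t)) := by
    have := congrArg (fun m => Measure.restrict m (Iio (T t)))
      (restrict_cumul_lt_top_eq hTm hT hright)
    simpa only [Measure.restrict_restrict measurableSet_Iio,
      inter_eq_self_of_subset_left hsub] using this
  rw [hres, setLIntegral_map measurableSet_Iio hf.ennreal_ofReal hTm,
    Measure.restrict_restrict (hTm measurableSet_Iio)]
  have hset : T ⁻¹' Iio (T t) ∩ Ioi 0 ⊆ Ioc 0 t := fun s hs =>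
    ⟨hs.2, (lt_of_quantile_lt hT hs.2 ht hs.1).le⟩
  refine le_trans (le_of_eq ?_) (lintegral_mono_set hset)
  refine setLIntegral_congr_fun ((hTm measurableSet_Iio).inter measurableSet_Ioi) fun s hs => ?_
  have hmem : T s ∈ {y | cumul ν y < ∞} := hsub hs.1
  rw [indicator_of_mem hmem]

theorem lintegral_rpow_indicator_quantile_le (hTm : Measurable T)
    (hT : ∀ s > 0, ∀ x, T s ≤ x ↔ ENNReal.ofReal s ≤ cumul ν x)
    (hright : ∀ x, cumul ν x < ∞ → ∃ y > x, cumul ν y < ∞) {f : ℝ → ℝ} (hf : Measurable f)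
    {p : ℝ} (hp : 0 < p) :
    ∫⁻ s in Ioi 0, ENNReal.ofReal (indicator {y | cumul ν y < ∞} f (T s) ^ p) ≤
      ∫⁻ y, ENNReal.ofReal (f y ^ p) ∂ν := by
  have hV := measurableSet_cumul_lt_top ν
  have hm : Measurable fun y => ENNReal.ofReal (indicator {y | cumul ν y < ∞} f y ^ p) :=
    ((hf.indicator hV).pow_const p).ennreal_ofReal
  have hind : (fun y => ENNReal.ofReal (indicator {y | cumul ν y < ∞} f y ^ p)) =
      indicator {y | cumul ν y < ∞} fun y => ENNReal.ofReal (f y ^ p) := by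
    ext y
    by_cases hy : y ∈ {y | cumul ν y < ∞}
    · rw [indicator_of_mem hy, indicator_of_mem hy]
    · rw [indicator_of_notMem hy, indicator_of_notMem hy, Real.zero_rpow hp.ne',
        ENNReal.ofReal_zero]
  rw [← lintegral_map hm hTm, hind, lintegral_indicator hV,
    ← restrict_cumul_lt_top_eq hTm hT hright]
  exact lintegral_mono' Measure.restrict_le_self le_rfl

end quantile

/-! ### Reduction to the half-line. -/

theorem lemma2p2 (p q : ℝ) (hp : 1 < p) (hpq : p ≤ q) (ν : Measure ℝ)
    (hS : Tendsto (cumul ν) atTop (𝓝 ∞)) :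
    ((∀ x, cumul ν x < ∞) → ∃ ν' : Measure ℝ, HasBlissTail q p ν ν') ∧
    ∀ ν' : Measure ℝ, HasBlissTail q p ν ν' →
      ∀ f : ℝ → ℝ, Measurable f → (∀ y, 0 ≤ f y) →
        (∫⁻ x, (∫⁻ y in Iio x, ENNReal.ofReal (f y) ∂ν) ^ q ∂ν') ^ (1 / q) ≤
          ENNReal.ofReal (sharpFactor q p) *
            (∫⁻ y, ENNReal.ofReal (f y ^ p) ∂ν) ^ (1 / p) := by
  have hp0 : 0 < p := by linarith
  have hp1 : 0 < p - 1 := by linarith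
  have hq0 : 0 < q := by linarith
  have hα : 0 < q / p.conjExponent := by rw [Real.conjExponent]; positivity
  constructor
  · intro hfin
    obtain ⟨T, hTm, hT⟩ := exists_quantile hS ⟨0, hfin 0⟩ fun x _ => ⟨x + 1, by simp, hfin _⟩
    exact ⟨(powerTail (q / p.conjExponent)).map T, map_quantile_powerTail_Ioi hα hTm hT⟩
  · intro ν' hν' f hf hf0
    by_cases hfin : ∃ x, cumul ν x < ∞
    swap
    · push Not at hfin
      rw [measure_eq_zero_of_tail hα hν' fun x => top_le_iff.1 (hfin x), lintegral_zero_measure,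
        ENNReal.zero_rpow_of_pos (by positivity)]
      exact zero_le
    have hright : ∀ x, cumul ν x < ∞ → ∃ y > x, cumul ν y < ∞ := fun x hx =>
      cumul_finite_right_of_tail hα hν' hx
    obtain ⟨T, hTm, hT⟩ := exists_quantile hS hfin hright
    set G : ℝ → ℝ≥0∞ := fun x => ∫⁻ y in Iio x, ENNReal.ofReal (f y) ∂ν with hG
    have hGm : Measurable fun x => G x ^ q := by
      have : Measurable G :=
        Monotone.measurable fun x y hxy => lintegral_mono_set (Iio_subset_Iio hxy)
      exact this.pow_const q
    -- Here ν' has infinite tails from every point further left and is not determined by them, but ν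
    -- has no mass strictly to the left, so the integrand is 0.
    have hzero : ∀ x ∉ {x | ∃ y < x, 0 < cumul ν y}, G x ^ q = 0 := by
      intro x hx
      have h0 : ν (Iio x) = 0 := measure_Iio_eq_zero_of_cumul fun y hy => by
        by_contra hne
        exact hx ⟨y, hy, pos_iff_ne_zero.2 hne⟩
      rw [hG]
      simp only
      rw [setLIntegral_measure_zero _ _ h0, ENNReal.zero_rpow_of_pos hq0]
    have hleft : ∫⁻ x, G x ^ q ∂ν' ≤ ∫⁻ t in Ioi (0 : ℝ),
        (∫⁻ s in Ioc 0 t, ENNReal.ofReal (indicator {y | cumul ν y < ∞} f (T s))) ^ q *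
          ENNReal.ofReal (q / p.conjExponent * t ^ (-(q / p.conjExponent + 1))) := by
      calc ∫⁻ x, G x ^ q ∂ν' = ∫⁻ x in {x | ∃ y < x, 0 < cumul ν y}, G x ^ q ∂ν' :=
            (setLIntegral_eq_of_support_subset (Function.support_subset_iff'.2 hzero)).symm
        _ = ∫⁻ x in {x | ∃ y < x, 0 < cumul ν y}, G x ^ q
              ∂((powerTail (q / p.conjExponent)).map T) := by
            rw [restrict_exists_cumul_pos_eq hα hTm hT hν']
        _ ≤ ∫⁻ x, G x ^ q ∂((powerTail (q / p.conjExponent)).map T) :=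
            lintegral_mono' Measure.restrict_le_self le_rfl
        _ = ∫⁻ t in Ioi (0 : ℝ), ENNReal.ofReal (q / p.conjExponent *
              t ^ (-(q / p.conjExponent + 1))) * G (T t) ^ q := by
            rw [lintegral_map hGm hTm, powerTail]
            exact lintegral_withDensity_eq_lintegral_mul _ (by fun_prop) (hGm.comp hTm)
        _ ≤ _ := by
            refine setLIntegral_mono' measurableSet_Ioi fun t ht => ?_
            rw [mul_comm]
            gcongr
            exact setLIntegral_Iio_quantile_le hTm hT hright hf ht
    calc (∫⁻ x, G x ^ q ∂ν') ^ (1 / q) ≤ _ := ENNReal.rpow_le_rpow hleft (by positivity)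
      _ ≤ _ := bliss_halfLine hp hpq
        ((hf.indicator (measurableSet_cumul_lt_top ν)).comp hTm)
        fun s => indicator_nonneg (fun y _ => hf0 y) _
      _ ≤ _ := mul_le_mul_right (ENNReal.rpow_le_rpow
        (lintegral_rpow_indicator_quantile_le hTm hT hright hf hp0) (by positivity)) _
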